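/- Let $m,n,p\ge 0$ be integers and let $s=s_1\dots s_{m+n}$ be a parity sequence, that is, $s_a\in\{0,1\}$ and exactly $m$ of the terms are $0$. The Yangian $\mathrm{Y}(\mathfrak{gl}^{\,s}_{m|n})$ is the $\mathbb{Z}_2$-graded associative algebra over $\mathbb{C}$ with generators $t_{ab}^{(r)}$ ($1\le a,b\le m+n$, $r\ge1$) of parity $s_a+s_b \bmod 2$ and the defining relations $$(u-v)\,[t_{ab}(u),t_{cd}(v)]=(-1)^{s_as_b+s_as_c+s_bs_c}\big(t_{cb}(u)\,t_{ad}(v)-t_{cb}(v)\,t_{ad}(u)\big),\qquad t_{ab}(u)=\delta_{ab}+\sum_{r\ge1}t_{ab}^{(r)}u^{-r},$$ where $[\ ,\ ]$ is the super-commutator. The Yangian of level $p$, $\mathrm{Y}_p(\mathfrak{gl}^{\,s}_{m|n})$, is its quotient by the two-sided ideal generated by all $t_{ab}^{(r)}$ with $r>p$; put $T_{ab}(u)=u^p\,t_{ab}(u)$, a polynomial in $u$ over this quotient. For a tuple $\lambda(u)=(\lambda_1(u),\dots,\lambda_{m+n}(u))$ of monic polynomials of degree $p$, the Verma module $M(\lambda(u))$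 associated with $s$ is the quotient of $\mathrm{Y}_p(\mathfrak{gl}^{\,s}_{m|n})$ by the left ideal generated by all coefficients of $T_{ab}(u)$ for $a<b$ and of $T_{aa}(u)-\lambda_a(u)$ for all $a$, and $L(\lambda(u))$ is its irreducible quotient, i.e. its quotient by the sum of all proper submodules. Let $\lambda_j(u)=(u+\lambda_j^{(1)})\cdots(u+\lambda_j^{(p)})$ with $\lambda_j^{(r)}\in\mathbb{C}$ for $j=1,\dots,m+n$. Fix $i$ with $1\le i<m+n$ and suppose that the parameters are numbered so that for some $k\in\{0,1,\dots,p\}$ we have $\lambda_i^{(r)}=\lambda_{i+1}^{(r)}$ for $r=k+1,\dots,p$, while $\lambda_i^{(r)}\ne\lambda_{i+1}^{(q)}$ for all $1\le r,q\le k$. Set $$\lambda_i^{\pm}(u)=\prod_{r=1}^{k}(u+\lambda_{i+1}^{(r)}\pm1)\prod_{r=k+1}^{p}(u+\lambda_{i+1}^{(r)}),\qquad \lambda_{i+1}^{\pm}(u)=\prod_{r=1}^{k}(u+\lambda_{i}^{(r)}\pm1)\prod_{r=k+1}^{p}(u+\lambda_{i}^{(r)}),$$ and $\lambda_j^{\pm}(u)=\lambda_j(u)$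 for $j\ne i,i+1$. Let $s'$ be the sequence obtained from $s$ by interchanging $s_i$ and $s_{i+1}$, write $s^-=s'$ if $s_is_{i+1}=01$ and $s^+=s'$ if $s_is_{i+1}=10$, and identify $\mathrm{Y}_p(\mathfrak{gl}^{\,s'}_{m|n})$ with $\mathrm{Y}_p(\mathfrak{gl}^{\,s}_{m|n})$ by the re-labelling isomorphism $t_{ab}(u)\mapsto t_{\sigma(a)\sigma(b)}(u)$, where $\sigma=(i,i+1)$ is the transposition. 1. If $s_is_{i+1}=01$, then the module $L(\lambda(u))$ associated with $s$ is isomorphic to the module $L(\lambda^-(u))$ associated with $s^-$. 2. If $s_is_{i+1}=10$, then the module $L(\lambda(u))$ associated with $s$ is isomorphic to the module $L(\lambda^+(u))$ associated with $s^+$. -/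

import Mathlib

open Polynomial

noncomputable section

/-- A parity sequence `s_1 … s_{m+n}`: each term is `0` or `1`, and exactly `m` terms are `0`.
Positions are numbered from `0` to `m + n - 1`. -/
structure ParitySequence (m n : ℕ) where
  /-- the terms of the sequence -/
  term : Fin (m + n) → ZMod 2
  /-- the total number of zeros is `m` -/
  card_zeros : (Finset.univ.filter fun a => term a = 0).card = m

namespace ParitySequence

variable {m n : ℕ}

/-- The sequence obtained from `s` by interchanging the terms in the positions `i` and `i'` and
leaving the remaining terms unchanged. -/
def interchange (s : ParitySequence m n) (i i' : Fin (m + n)) : ParitySequence m n where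
  term a := s.term (Equiv.swap i i' a)
  card_zeros := by
    refine Eq.trans ?_ s.card_zeros
    refine Finset.card_equiv (Equiv.swap i i') fun a => ?_
    simp

end ParitySequence

/-- `(-1)^x` for a parity `x`. -/
def paritySign (x : ZMod 2) : ℂ := if x = 0 then 1 else -1

namespace Yangian

variable {m n : ℕ}

/-- The free algebra on symbols `(i, j, r)`; the symbol `(i, j, r)` stands for `t_{ij}^{(r+1)}`. -/
abbrev Free (m n : ℕ) : Type := FreeAlgebra ℂ (Fin (m + n) × Fin (m + n) × ℕ)

/-- The coefficient of `u^{-r}` in the series `t_{ij}(u) = δ_{ij} + ∑_{r ≥ 1} t_{ij}^{(r)} u^{-r}`,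
in the free algebra. -/
def freeT (i j : Fin (m + n)) : ℕ → Free m n
  | 0 => if i = j then 1 else 0
  | r + 1 => FreeAlgebra.ι ℂ (i, j, r)

/-- The super-commutator `[t_{ij}^{(r)}, t_{kl}^{(q)}]` in the free algebra, where `t_{ij}^{(r)}` has
parity `s_i + s_j`. -/
def freeBracket (s : ParitySequence m n) (i j : Fin (m + n)) (r : ℕ) (k l : Fin (m + n)) (q : ℕ) :
    Free m n :=
  freeT i j r * freeT k l q -
    paritySign ((s.term i + s.term j) * (s.term k + s.term l)) • (freeT k l q * freeT i j r)

/-- The defining relations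
`(u - v) [t_{ij}(u), t_{kl}(v)]
  = (t_{kj}(u) t_{il}(v) - t_{kj}(v) t_{il}(u)) (-1)^{s_i s_j + s_i s_k + s_j s_k}`,
in terms of the coefficients of `u^{-r} v^{-q}` (those of `u v^{-q}` and `u^{-r} v` hold
trivially). -/
inductive Rel (s : ParitySequence m n) : Free m n → Free m n → Prop
  | defining (i j k l : Fin (m + n)) (r q : ℕ) :
      Rel s (freeBracket s i j (r + 1) k l q - freeBracket s i j r k l (q + 1))
        (paritySign (s.term i * s.term j + s.term i * s.term k + s.term j * s.term k) •
          (freeT k j r * freeT i l q - freeT k j q * freeT i l r))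

end Yangian

/-- The Yangian `Y(gl_{m|n}^s)`. The relations are homogeneous, so that the parities `s_i + s_j` of
the generators `t_{ij}^{(r)}` determine its `ℤ/2`-gradation. -/
def Yangian {m n : ℕ} (s : ParitySequence m n) : Type := RingQuot (Yangian.Rel s)

namespace Yangian

variable {m n : ℕ}

instance (s : ParitySequence m n) : Ring (Yangian s) :=
  inferInstanceAs (Ring (RingQuot (Rel s)))

instance (s : ParitySequence m n) : Algebra ℂ (Yangian s) :=
  inferInstanceAs (Algebra ℂ (RingQuot (Rel s)))

/-- The quotient map from the free algebra to `Y(gl_{m|n}^s)`. -/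
def mk (s : ParitySequence m n) : Free m n →ₐ[ℂ] Yangian s := RingQuot.mkAlgHom ℂ (Rel s)

theorem mk_rel {s : ParitySequence m n} {x y : Free m n} (h : Rel s x y) : mk s x = mk s y :=
  RingQuot.mkAlgHom_rel ℂ h

/-- The universal property of `Y(gl_{m|n}^s)`. -/
def lift (s : ParitySequence m n) {A : Type} [Semiring A] [Algebra ℂ A] (f : Free m n →ₐ[ℂ] A)
    (hf : ∀ ⦃x y⦄, Rel s x y → f x = f y) : Yangian s →ₐ[ℂ] A :=
  RingQuot.liftAlgHom ℂ ⟨f, hf⟩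

@[simp]
theorem lift_mk (s : ParitySequence m n) {A : Type} [Semiring A] [Algebra ℂ A]
    (f : Free m n →ₐ[ℂ] A) (hf : ∀ ⦃x y⦄, Rel s x y → f x = f y) (x : Free m n) :
    lift s f hf (mk s x) = f x :=
  RingQuot.liftAlgHom_mkAlgHom_apply ℂ f hf x

/-- The element `t_{ij}^{(r)}` of `Y(gl_{m|n}^s)`, with `t_{ij}^{(0)} = δ_{ij}`. -/
def t (s : ParitySequence m n) (i j : Fin (m + n)) (r : ℕ) : Yangian s :=
  mk s (freeT i j r)

/-- The relations `t_{ij}^{(r)} = 0` for `r > p`. -/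
inductive LevelRel (s : ParitySequence m n) (p : ℕ) : Yangian s → Yangian s → Prop
  | vanish (i j : Fin (m + n)) (r : ℕ) (hr : p < r) : LevelRel s p (t s i j r) 0

end Yangian

/-- The Yangian `Y_p(gl_{m|n}^s)` of level `p`: the quotient of `Y(gl_{m|n}^s)` by the two-sided
ideal generated by all `t_{ij}^{(r)}` with `r > p`. -/
def LevelYangian {m n : ℕ} (s : ParitySequence m n) (p : ℕ) : Type :=
  RingQuot (Yangian.LevelRel s p)

namespace LevelYangian

variable {m n : ℕ}

instance (s : ParitySequence m n) (p : ℕ) : Ring (LevelYangian s p) :=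
  inferInstanceAs (Ring (RingQuot (Yangian.LevelRel s p)))

instance (s : ParitySequence m n) (p : ℕ) : Algebra ℂ (LevelYangian s p) :=
  inferInstanceAs (Algebra ℂ (RingQuot (Yangian.LevelRel s p)))

/-- The quotient map `Y(gl_{m|n}^s) → Y_p(gl_{m|n}^s)`. -/
def mk (s : ParitySequence m n) (p : ℕ) : Yangian s →ₐ[ℂ] LevelYangian s p :=
  RingQuot.mkAlgHom ℂ (Yangian.LevelRel s p)

theorem mk_rel {s : ParitySequence m n} {p : ℕ} {x y : Yangian s} (h : Yangian.LevelRel s p x y) :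
    mk s p x = mk s p y :=
  RingQuot.mkAlgHom_rel ℂ h

/-- The universal property of `Y_p(gl_{m|n}^s)` as a quotient of `Y(gl_{m|n}^s)`. -/
def lift (s : ParitySequence m n) (p : ℕ) {A : Type} [Semiring A] [Algebra ℂ A]
    (f : Yangian s →ₐ[ℂ] A) (hf : ∀ ⦃x y⦄, Yangian.LevelRel s p x y → f x = f y) :
    LevelYangian s p →ₐ[ℂ] A :=
  RingQuot.liftAlgHom ℂ ⟨f, hf⟩

@[simp]
theorem lift_mk (s : ParitySequence m n) (p : ℕ) {A : Type} [Semiring A] [Algebra ℂ A]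
    (f : Yangian s →ₐ[ℂ] A) (hf : ∀ ⦃x y⦄, Yangian.LevelRel s p x y → f x = f y) (x : Yangian s) :
    lift s p f hf (mk s p x) = f x :=
  RingQuot.liftAlgHom_mkAlgHom_apply ℂ f hf x

/-- The image of `t_{ij}^{(r)}` in `Y_p(gl_{m|n}^s)`. -/
def t (s : ParitySequence m n) (p : ℕ) (i j : Fin (m + n)) (r : ℕ) : LevelYangian s p :=
  mk s p (Yangian.t s i j r)

/-- The polynomial `T_{ij}(u) = u^p t_{ij}(u) = δ_{ij} u^p + t_{ij}^{(1)} u^{p-1} + ⋯ + t_{ij}^{(p)}`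
with coefficients in `Y_p(gl_{m|n}^s)`. -/
def T (s : ParitySequence m n) (p : ℕ) (i j : Fin (m + n)) : (LevelYangian s p)[X] :=
  ∑ r ∈ Finset.range (p + 1), monomial (p - r) (t s p i j r)

/-- The left ideal of `Y_p(gl_{m|n}^s)` generated by all coefficients of `T_{ij}(u)` with `i < j` and
of `T_{ii}(u) - λ_i(u)`. -/
def vermaIdeal (s : ParitySequence m n) (p : ℕ) (lam : Fin (m + n) → ℂ[X]) :
    Submodule (LevelYangian s p) (LevelYangian s p) :=
  Submodule.span (LevelYangian s p)
    ({y | ∃ i j : Fin (m + n), ∃ d : ℕ, i < j ∧ y = (T s p i j).coeff d} ∪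
      {y | ∃ i : Fin (m + n), ∃ d : ℕ,
        y = (T s p i i - (lam i).map (algebraMap ℂ (LevelYangian s p))).coeff d})

/-- The Verma module `M(λ(u))` over `Y_p(gl_{m|n}^s)`. -/
abbrev Verma (s : ParitySequence m n) (p : ℕ) (lam : Fin (m + n) → ℂ[X]) : Type :=
  LevelYangian s p ⧸ vermaIdeal s p lam

/-- The sum of all proper submodules of `M(λ(u))`, that is, its unique maximal proper submodule.
(All submodules are sums of weight subspaces for the elements `t_{ii}^{(1)}`; in particular they are
`ℤ/2`-graded, and the proper ones do not contain the highest vector.) -/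
def maxSubmodule (s : ParitySequence m n) (p : ℕ) (lam : Fin (m + n) → ℂ[X]) :
    Submodule (LevelYangian s p) (Verma s p lam) :=
  sSup {N | N ≠ ⊤}

/-- The irreducible highest weight module `L(λ(u))` over `Y_p(gl_{m|n}^s)`: the irreducible quotient
of the Verma module `M(λ(u))`. -/
abbrev L (s : ParitySequence m n) (p : ℕ) (lam : Fin (m + n) → ℂ[X]) : Type :=
  Verma s p lam ⧸ maxSubmodule s p lam

end LevelYangian

namespace Yangian

variable {m n : ℕ}

/-- The substitution of indices in the free algebra. -/
def freeRelabel (σ : Equiv.Perm (Fin (m + n))) : Free m n →ₐ[ℂ] Free m n :=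
  FreeAlgebra.lift ℂ fun x => FreeAlgebra.ι ℂ (σ x.1, σ x.2.1, x.2.2)

theorem freeRelabel_freeT (σ : Equiv.Perm (Fin (m + n))) (i j : Fin (m + n)) (r : ℕ) :
    freeRelabel σ (freeT i j r) = freeT (σ i) (σ j) r := by
  cases r with
  | zero =>
    by_cases h : i = j
    · simp [freeT, h]
    · simp [freeT, h]
  | succ r => simp [freeT, freeRelabel]

/-- The re-labelling homomorphism `Y(gl^{s'}) → Y(gl^s)`, `t_{ij}(u) ↦ t_{σ(i)σ(j)}(u)`. -/
def relabelHom (s' s : ParitySequence m n) (σ : Equiv.Perm (Fin (m + n)))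
    (h : ∀ a, s'.term a = s.term (σ a)) : Yangian s' →ₐ[ℂ] Yangian s :=
  lift s' ((mk s).comp (freeRelabel σ)) <| by
    rintro _ _ ⟨i, j, k, l, r, q⟩
    have key := mk_rel (Rel.defining (s := s) (σ i) (σ j) (σ k) (σ l) r q)
    simpa [freeBracket, freeRelabel_freeT, h] using key

theorem relabelHom_t (s' s : ParitySequence m n) (σ : Equiv.Perm (Fin (m + n)))
    (h : ∀ a, s'.term a = s.term (σ a)) (i j : Fin (m + n)) (r : ℕ) :
    relabelHom s' s σ h (t s' i j r) = t s (σ i) (σ j) r := by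
  simp [relabelHom, t, freeRelabel_freeT]

end Yangian

namespace LevelYangian

variable {m n : ℕ}

/-- The re-labelling homomorphism `Y_p(gl^{s'}) → Y_p(gl^s)`, `t_{ij}(u) ↦ t_{σ(i)σ(j)}(u)`. -/
def relabelHom (s' s : ParitySequence m n) (p : ℕ) (σ : Equiv.Perm (Fin (m + n)))
    (h : ∀ a, s'.term a = s.term (σ a)) : LevelYangian s' p →ₐ[ℂ] LevelYangian s p :=
  lift s' p ((mk s p).comp (Yangian.relabelHom s' s σ h)) <| by
    rintro _ _ ⟨i, j, r, hr⟩
    have key := mk_rel (Yangian.LevelRel.vanish (s := s) (σ i) (σ j) r hr)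
    simpa [Yangian.relabelHom_t] using key

theorem relabelHom_t (s' s : ParitySequence m n) (p : ℕ) (σ : Equiv.Perm (Fin (m + n)))
    (h : ∀ a, s'.term a = s.term (σ a)) (i j : Fin (m + n)) (r : ℕ) :
    relabelHom s' s p σ h (t s' p i j r) = t s p (σ i) (σ j) r := by
  simp [relabelHom, t, Yangian.relabelHom_t]

theorem algHom_ext {s : ParitySequence m n} {p : ℕ} {A : Type} [Semiring A] [Algebra ℂ A]
    {f g : LevelYangian s p →ₐ[ℂ] A} (h : ∀ i j r, f (t s p i j r) = g (t s p i j r)) : f = g := by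
  apply RingQuot.ringQuot_ext'
  apply RingQuot.ringQuot_ext'
  apply FreeAlgebra.hom_ext
  funext ⟨i, j, r⟩
  exact h i j (r + 1)

/-- The re-labelling isomorphism `Y_p(gl^{s'}) → Y_p(gl^s)`, `t_{ij}(u) ↦ t_{σ(i)σ(j)}(u)`, for a
permutation `σ` that preserves the parities. -/
def relabel (s' s : ParitySequence m n) (p : ℕ) (σ : Equiv.Perm (Fin (m + n)))
    (h : ∀ a, s'.term a = s.term (σ a)) : LevelYangian s' p ≃ₐ[ℂ] LevelYangian s p :=
  AlgEquiv.ofAlgHom (relabelHom s' s p σ h)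
    (relabelHom s s' p σ.symm fun a => by rw [h, Equiv.apply_symm_apply])
    (algHom_ext fun i j r => by simp [relabelHom_t])
    (algHom_ext fun i j r => by simp [relabelHom_t])

/-- The isomorphism `Y_p(gl^{s'}) → Y_p(gl^s)` for the sequence `s'` obtained from `s` by
interchanging the terms in the positions `i` and `i'`: it is the re-labelling by the transposition
`(i, i')`. -/
def interchangeEquiv (s : ParitySequence m n) (p : ℕ) (i i' : Fin (m + n)) :
    LevelYangian (s.interchange i i') p ≃ₐ[ℂ] LevelYangian s p :=
  relabel (s.interchange i i') s p (Equiv.swap i i') fun _ => rfl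

end LevelYangian

/-- The `A`-module `V` is isomorphic to the `B`-module `W` when `A` and `B` are identified by means
of the algebra isomorphism `f : B → A`: the `B`-module obtained from `V` by twisting the action with
`f` is isomorphic to `W`. -/
def IsomorphicAlong {A B : Type} [Ring A] [Ring B] [Algebra ℂ A] [Algebra ℂ B] (f : B ≃ₐ[ℂ] A)
    (V W : Type) [AddCommGroup V] [AddCommGroup W] [Module ℂ V] [Module ℂ W]
    [Module A V] [Module B W] : Prop :=
  ∃ φ : V ≃ₗ[ℂ] W, ∀ (b : B) (v : V), φ (f b • v) = b • φ v

/-- The polynomials `λ_j(u) = (u + λ_j^{(1)}) ⋯ (u + λ_j^{(p)})`. -/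
def highestWeight {N p : ℕ} (a : Fin N → Fin p → ℂ) (j : Fin N) : ℂ[X] :=
  ∏ r : Fin p, (X + C (a j r))

/-- The product `(u + c_1 + ε) ⋯ (u + c_k + ε) (u + c_{k+1}) ⋯ (u + c_p)`. -/
def shiftedProduct {p : ℕ} (ε : ℂ) (k : ℕ) (c : Fin p → ℂ) : ℂ[X] :=
  ∏ r : Fin p, if (r : ℕ) < k then X + C (c r + ε) else X + C (c r)

/-- The polynomials `λ^±_j(u)`, for `ε = ±1` and the adjacent positions `i` and `i' = i + 1`. -/
def reflectedWeight {N p : ℕ} (ε : ℂ) (k : ℕ) (i i' : Fin N) (a : Fin N → Fin p → ℂ)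
    (j : Fin N) : ℂ[X] :=
  if j = i then shiftedProduct ε k (a i')
  else if j = i' then shiftedProduct ε k (a i)
  else highestWeight a j

end

/-!
Let `V = L(λ(u))` with highest vector `ζ`, and write `A`, `B`, `C`, `D` for the polynomials `T_{ii}`,
`T_{ii'}`, `T_{i'i}`, `T_{i'i'}` of two adjacent indices of different parities. The isomorphism amounts
to the existence of a nonzero vector `η` in `V` that is a highest vector for the order of the indices
with `i` and `i'` interchanged, and has the reflected weight: a simple module with a highest vector of
weight `μ(u)` is `L(μ(u))` (`LevelYangian.nonempty_equiv_L`). That the sum of the proper submodules of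
a nonzero Verma module is proper follows from a grading by the eigenvalues of a single element
(`LevelYangian.gradingElement`) and from the spanning part of the triangular decomposition
(`LevelYangian.smul_mem_iSup_loweringSpan`). The Verma modules need not be known to be nonzero, because
the reflection in the opposite direction shows that either both of them vanish or none does.

The vector `η` is found in the span `W` of the vectors `C(x_1) ⋯ C(x_j) ζ`. All of `W` satisfies the
conditions on a highest vector that do not involve `i` and `i'` alone
(`LevelYangian.evalT_smul_mem_leviSpace`), so that the problem is one about four families of operators
that obey the relations of the Yangian of `gl_{1|1}` (`OddPair`).

* Because `C(x) C(x - 1) = 0`, and the `C(x)` commute up to scalar factors, a product of `p` of them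
  with generic arguments is annihilated by `C(u)`, a polynomial with `p` coefficients. Hence `C(u)`
  annihilates some nonzero element of some span `W_j` of words of length `j`
  (`OddPair.exists_word_opC_eq_zero`), and as `W_j` is of finite dimension, also a common eigenvector
  `η` of the commuting operators `A(x)`.
* The Berezinian acts on `W` as a scalar. In a form without inverses, this reads
  `λ_i(x - 1) (A(x) D(x - 1) - C(x) B(x - 1)) = λ_{i'}(x - 1) A(x) A(x - 1)` (`OddPair.opP_words`).
  On `η` it shows that `D(x) η = δ(x) η` and
  `λ_i(x - 1) δ(x) = λ_{i'}(x - 1) α(x)`, where `A(x) η = α(x) η`.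
* Let `g` be the common factor of `λ_i` and `λ_{i'}`. As `V` is simple, `C(u) ζ` is divisible by `g`,
  since its remainder modulo `g` consists of singular vectors. Then `g` divides `A(u) w`, `C(u) w` and
  `D(u) w` for all `w` in `W` (`OddPair.words_le_dvdSubmodule`), and in particular `α` and `δ`.

For `λ_i = g m₁` and `λ_{i'} = g m₂` with coprime `m₁` and `m₂`, comparison of degrees gives
`α(u) = g(u) m₁(u - 1)` and `δ(u) = g(u) m₂(u - 1)`, the reflected weight. These formulas are for the
parities `01`; the substitution of `-u` for `u` reduces the parities `10` to them.
-/

noncomputable section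

/-! ### Polynomial functions with values in a vector space -/

section VectorPolynomial

variable {M : Type*} [AddCommGroup M] [Module ℂ M]

/-- The value at `x` of the polynomial `c_0 u^p + c_1 u^{p-1} + ⋯ + c_p` with coefficients in a
vector space. -/
def vecEval (p : ℕ) (c : ℕ → M) (x : ℂ) : M :=
  ∑ r ∈ Finset.range (p + 1), x ^ (p - r) • c r

/-- The complex polynomial obtained from `c_0 u^p + c_1 u^{p-1} + ⋯ + c_p` by applying the linear
functional `f` to the coefficients. -/
def dualPoly (p : ℕ) (c : ℕ → M) (f : M →ₗ[ℂ] ℂ) : ℂ[X] :=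
  ∑ r ∈ Finset.range (p + 1), C (f (c r)) * X ^ (p - r)

theorem eval_dualPoly (p : ℕ) (c : ℕ → M) (f : M →ₗ[ℂ] ℂ) (x : ℂ) :
    (dualPoly p c f).eval x = f (vecEval p c x) := by
  simp [dualPoly, vecEval, eval_finsetSum, mul_comm (f _)]

theorem coeff_dualPoly {p : ℕ} (c : ℕ → M) (f : M →ₗ[ℂ] ℂ) {r : ℕ} (hr : r ≤ p) :
    (dualPoly p c f).coeff (p - r) = f (c r) := by
  simp only [dualPoly, finsetSum_coeff, coeff_C_mul, coeff_X_pow]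
  rw [Finset.sum_eq_single r]
  · simp
  · intro b hb hbr
    rw [Finset.mem_range] at hb
    rw [if_neg (by omega), mul_zero]
  · intro h
    exact absurd (Finset.mem_range.2 (by omega)) h

theorem natDegree_dualPoly_le (p : ℕ) (c : ℕ → M) (f : M →ₗ[ℂ] ℂ) :
    (dualPoly p c f).natDegree ≤ p := by
  refine natDegree_sum_le_of_forall_le _ _ fun r _ => ?_
  exact (natDegree_C_mul_X_pow_le _ _).trans (Nat.sub_le _ _)

theorem monic_dualPoly (p : ℕ) (c : ℕ → M) (f : M →ₗ[ℂ] ℂ) (h : f (c 0) = 1) :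
    (dualPoly p c f).Monic ∧ (dualPoly p c f).natDegree = p := by
  have h1 : (dualPoly p c f).coeff p = 1 := by
    simpa [h] using coeff_dualPoly c f (Nat.zero_le p)
  have h2 := natDegree_dualPoly_le p c f
  exact ⟨monic_of_natDegree_le_of_coeff_eq_one p h2 h1,
    le_antisymm h2 (le_natDegree_of_ne_zero (by simp [h1]))⟩

theorem vecEval_mem {p : ℕ} {c : ℕ → M} {U : Submodule ℂ M} (h : ∀ r ≤ p, c r ∈ U) (x : ℂ) :
    vecEval p c x ∈ U :=
  Submodule.sum_mem _ fun r hr =>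
    U.smul_mem _ (h r (by rw [Finset.mem_range] at hr; omega))

theorem vecEval_apply {M' : Type*} [AddCommGroup M'] [Module ℂ M'] (p : ℕ)
    (c : ℕ → M →ₗ[ℂ] M') (x : ℂ) (v : M) :
    vecEval p c x v = vecEval p (fun r => c r v) x := by
  simp [vecEval]

/-- A polynomial whose values at infinitely many points lie in a subspace has its coefficients in
that subspace. -/
theorem coeff_mem_of_infinite {p : ℕ} {c : ℕ → M} {U : Submodule ℂ M}
    (h : {x | vecEval p c x ∈ U}.Infinite) {r : ℕ} (hr : r ≤ p) : c r ∈ U := by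
  rw [← Submodule.Quotient.mk_eq_zero, ← Module.forall_dual_apply_eq_zero_iff ℂ]
  intro f
  have h0 : dualPoly p c (f ∘ₗ U.mkQ) = 0 := by
    refine eq_zero_of_infinite_isRoot _ (h.mono fun x hx => ?_)
    have hx' : U.mkQ (vecEval p c x) = 0 := by simpa using hx
    simp only [IsRoot, Set.mem_ofPred_eq, eval_dualPoly, LinearMap.comp_apply, hx', map_zero]
  simpa [h0] using (coeff_dualPoly c (f ∘ₗ U.mkQ) hr).symm

theorem vecEval_mem_of_infinite {p : ℕ} {c : ℕ → M} {U : Submodule ℂ M}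
    (h : {x | vecEval p c x ∈ U}.Infinite) (x : ℂ) : vecEval p c x ∈ U :=
  vecEval_mem (fun _ hr => coeff_mem_of_infinite h hr) x

theorem coeff_eq_zero_of_vecEval {p : ℕ} {c : ℕ → M} (h : ∀ x, vecEval p c x = 0) {r : ℕ}
    (hr : r ≤ p) : c r = 0 := by
  have := coeff_mem_of_infinite (p := p) (c := c) (U := ⊥) (by simp [h, Set.infinite_univ]) hr
  simpa using this

/-- A polynomial of degree less than `p` with `p` zeros vanishes. -/
theorem vecEval_eq_zero_of_card {p : ℕ} {c : ℕ → M} (h0 : c 0 = 0) (S : Finset ℂ)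
    (hS : p ≤ S.card) (h : ∀ x ∈ S, vecEval p c x = 0) (x : ℂ) : vecEval p c x = 0 := by
  rw [← Module.forall_dual_apply_eq_zero_iff ℂ]
  intro f
  rw [← eval_dualPoly]
  have hq : dualPoly p c f = 0 := by
    rcases Nat.eq_zero_or_pos p with rfl | hp
    · simp [dualPoly, h0]
    refine eq_zero_of_degree_lt_of_eval_finset_eq_zero S ?_ fun x hx => by
      rw [eval_dualPoly, h x hx, map_zero]
    refine lt_of_lt_of_le ?_ (Nat.cast_le.2 hS)
    rw [degree_lt_iff_coeff_zero]
    intro m hm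
    rcases hm.eq_or_lt with rfl | hm
    · simpa [h0] using coeff_dualPoly c f (Nat.zero_le p)
    · exact coeff_eq_zero_of_natDegree_lt ((natDegree_dualPoly_le p c f).trans_lt hm)
  simp [hq]

theorem infinite_compl_finset (S : Finset ℂ) : {x : ℂ | x ∉ S}.Infinite :=
  S.finite_toSet.infinite_compl

end VectorPolynomial

/-- Commuting operators that preserve a nonzero finite-dimensional subspace have a common
eigenvector in it. -/
theorem exists_common_eigenvector {V ι : Type*} [AddCommGroup V] [Module ℂ V]
    (F : ι → Module.End ℂ V) (hF : ∀ x y v, F x (F y v) = F y (F x v)) (K : Submodule ℂ V)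
    [FiniteDimensional ℂ K] (hK : K ≠ ⊥) (hinv : ∀ x, ∀ v ∈ K, F x v ∈ K) :
    ∃ v ∈ K, v ≠ 0 ∧ ∀ x, ∃ μ : ℂ, F x v = μ • v := by
  induction hn : Module.finrank ℂ K using Nat.strong_induction_on generalizing K with
  | _ n ih =>
    by_cases hs : ∀ x, ∃ μ : ℂ, ∀ v ∈ K, F x v = μ • v
    · obtain ⟨v, hv, hv0⟩ := Submodule.exists_mem_ne_zero_of_ne_bot hK
      exact ⟨v, hv, hv0, fun x => (hs x).imp fun μ h => h v hv⟩
    push Not at hs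
    obtain ⟨x, hx⟩ := hs
    have : Nontrivial K := (Submodule.nontrivial_iff_ne_bot).2 hK
    obtain ⟨μ, hμ⟩ := Module.End.exists_eigenvalue ((F x).restrict (hinv x))
    obtain ⟨w, hw⟩ := hμ.exists_hasEigenvector
    obtain ⟨u, hu, hu'⟩ := hx μ
    let K' : Submodule ℂ V := K ⊓ LinearMap.ker (F x - μ • 1)
    have hmem : ∀ v, v ∈ K' ↔ v ∈ K ∧ F x v = μ • v := fun v => by
      simp [K', Submodule.mem_inf, LinearMap.mem_ker, sub_eq_zero]
    have hlt : K' < K :=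
      lt_of_le_of_ne inf_le_left fun h => hu' ((hmem u).1 (h ▸ hu)).2
    have : FiniteDimensional ℂ K' := Submodule.finiteDimensional_of_le inf_le_left
    have hw' : (w : V) ∈ K' :=
      (hmem _).2 ⟨w.2, by simpa using congrArg Subtype.val hw.apply_eq_smul⟩
    have hne : K' ≠ ⊥ := fun h => by
      rw [h, Submodule.mem_bot] at hw'
      exact hw.2 (Subtype.ext hw')
    obtain ⟨v, hv, hv'⟩ := ih _ (hn ▸ Submodule.finrank_lt_finrank_of_lt hlt) K' hne
      (fun y v hv => (hmem _).2 ⟨hinv y v hv.1, by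
        rw [hF, ((hmem v).1 hv).2, map_smul]⟩) rfl
    exact ⟨v, hv.1, hv'⟩

/-! ### The defining relations evaluated at complex numbers -/

theorem paritySign_mul_self (x : ZMod 2) : paritySign x * paritySign x = 1 := by
  unfold paritySign; split_ifs <;> norm_num

theorem vecEval_shift {M : Type*} [AddCommGroup M] [Module ℂ M] {p : ℕ} {c : ℕ → M}
    (h0 : c 0 = 0) (hp : c (p + 1) = 0) (x : ℂ) :
    vecEval p (fun r => c (r + 1)) x = x • vecEval p c x := by
  unfold vecEval
  rw [Finset.sum_range_succ, Finset.sum_range_succ' (fun r => x ^ (p - r) • c r)]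
  simp only [hp, h0]
  rw [smul_zero, smul_zero, add_zero, add_zero, Finset.smul_sum]
  refine Finset.sum_congr rfl fun r hr => ?_
  rw [Finset.mem_range] at hr
  rw [smul_smul, ← pow_succ', show p - (r + 1) + 1 = p - r by omega]

theorem vecEval_sub {M : Type*} [AddCommGroup M] [Module ℂ M] (p : ℕ) (c d : ℕ → M) (x : ℂ) :
    vecEval p (fun r => c r - d r) x = vecEval p c x - vecEval p d x := by
  simp [vecEval, Finset.sum_sub_distrib, smul_sub]

theorem vecEval_smul {M : Type*} [AddCommGroup M] [Module ℂ M] (p : ℕ) (e : ℂ) (c : ℕ → M)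
    (x : ℂ) : vecEval p (fun r => e • c r) x = e • vecEval p c x := by
  simp [vecEval, Finset.smul_sum, smul_comm e]

theorem vecEval_mul_vecEval {R : Type*} [Ring R] [Algebra ℂ R] (p : ℕ) (c d : ℕ → R) (x y : ℂ) :
    vecEval p c x * vecEval p d y = vecEval p (fun r => vecEval p (fun q => c r * d q) y) x := by
  simp only [vecEval, Finset.sum_mul, smul_mul_assoc, Finset.mul_sum, mul_smul_comm,
    Finset.smul_sum]
  rw [Finset.sum_comm]
  simp only [smul_comm (y ^ _)]

theorem vecEval_mul_vecEval' {R : Type*} [Ring R] [Algebra ℂ R] (p : ℕ) (c d : ℕ → R) (x y : ℂ) :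
    vecEval p d y * vecEval p c x = vecEval p (fun r => vecEval p (fun q => d q * c r) y) x := by
  simp only [vecEval, Finset.sum_mul, smul_mul_assoc, Finset.mul_sum, mul_smul_comm]

namespace LevelYangian

variable {m n : ℕ} (s : ParitySequence m n) (p : ℕ)

theorem t_zero (i j : Fin (m + n)) : t s p i j 0 = if i = j then 1 else 0 := by
  unfold t Yangian.t Yangian.freeT
  split_ifs <;> simp

theorem t_eq_zero (i j : Fin (m + n)) {r : ℕ} (hr : p < r) : t s p i j r = 0 := by
  simpa [t] using mk_rel (Yangian.LevelRel.vanish (s := s) i j r hr)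

/-- The sign in the super-commutator of `t_{ij}(u)` with `t_{kl}(v)`. -/
def commSign (i j k l : Fin (m + n)) : ℂ :=
  paritySign ((s.term i + s.term j) * (s.term k + s.term l))

/-- The sign on the right-hand side of the defining relations. -/
def relSign (i j k : Fin (m + n)) : ℂ :=
  paritySign (s.term i * s.term j + s.term i * s.term k + s.term j * s.term k)

/-- The super-commutator of `t_{ij}^{(r)}` with `t_{kl}^{(q)}`. -/
def bracket (i j : Fin (m + n)) (r : ℕ) (k l : Fin (m + n)) (q : ℕ) : LevelYangian s p :=
  t s p i j r * t s p k l q - commSign s i j k l • (t s p k l q * t s p i j r)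

theorem commSign_self (i k l : Fin (m + n)) : commSign s i i k l = 1 := by
  simp [commSign, CharTwo.add_self_eq_zero, paritySign]

theorem commSign_symm (i j k l : Fin (m + n)) : commSign s i j k l = commSign s k l i j := by
  simp [commSign, mul_comm]

theorem commSign_mul_self (i j k l : Fin (m + n)) :
    commSign s i j k l * commSign s i j k l = 1 := paritySign_mul_self _

theorem relSign_self (i k : Fin (m + n)) : relSign s i i k = paritySign (s.term i) := by
  have h : ∀ x y : ZMod 2, x * x + x * y + x * y = x := by decide
  simp [relSign, h]

theorem bracket_zero_left (i j k l : Fin (m + n)) (q : ℕ) : bracket s p i j 0 k l q = 0 := by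
  unfold bracket
  rw [t_zero]
  split_ifs with h
  · subst h; simp [commSign_self]
  · simp

theorem bracket_symm (i j : Fin (m + n)) (r : ℕ) (k l : Fin (m + n)) (q : ℕ) :
    bracket s p i j r k l q = -(commSign s i j k l • bracket s p k l q i j r) := by
  unfold bracket
  rw [commSign_symm s k l i j, smul_sub, smul_smul, commSign_mul_self, one_smul, neg_sub]

theorem bracket_zero_right (i j : Fin (m + n)) (r : ℕ) (k l : Fin (m + n)) :
    bracket s p i j r k l 0 = 0 := by
  rw [bracket_symm, bracket_zero_left, smul_zero, neg_zero]

theorem bracket_rel (i j k l : Fin (m + n)) (r q : ℕ) :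
    bracket s p i j (r + 1) k l q - bracket s p i j r k l (q + 1) =
      relSign s i j k • (t s p k j r * t s p i l q - t s p k j q * t s p i l r) := by
  have h := congrArg (mk s p) (Yangian.mk_rel (Yangian.Rel.defining (s := s) i j k l r q))
  simpa only [Yangian.freeBracket, map_sub, map_mul, map_smul, bracket, commSign, relSign, t,
    Yangian.t] using h

/-- The super-commutators are combinations of products `t_{kj}^{(x)} t_{il}^{(y)}`. -/
theorem bracket_mem_span (i j : Fin (m + n)) (r : ℕ) (k l : Fin (m + n)) (q : ℕ) :
    bracket s p i j r k l q ∈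
      Submodule.span ℂ (Set.range fun x : ℕ × ℕ => t s p k j x.1 * t s p i l x.2) := by
  induction r generalizing q with
  | zero => rw [bracket_zero_left]; exact Submodule.zero_mem _
  | succ r ih =>
    rw [sub_eq_iff_eq_add.1 (bracket_rel s p i j k l r q)]
    refine Submodule.add_mem _ (Submodule.smul_mem _ _ (Submodule.sub_mem _ ?_ ?_)) (ih _)
    · exact Submodule.subset_span ⟨(r, q), rfl⟩
    · exact Submodule.subset_span ⟨(q, r), rfl⟩

/-- The super-commutators are combinations of products `t_{il}^{(x)} t_{kj}^{(y)}`. -/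
theorem bracket_mem_span' (i j : Fin (m + n)) (r : ℕ) (k l : Fin (m + n)) (q : ℕ) :
    bracket s p i j r k l q ∈
      Submodule.span ℂ (Set.range fun x : ℕ × ℕ => t s p i l x.1 * t s p k j x.2) := by
  rw [bracket_symm]
  exact Submodule.neg_mem _ (Submodule.smul_mem _ _ (bracket_mem_span s p k l q i j r))

/-- The value `T_{ij}(x)` of the polynomial `T_{ij}(u)` at a complex number `x`. -/
def evalT (i j : Fin (m + n)) (x : ℂ) : LevelYangian s p := vecEval p (t s p i j) x

theorem evalT_rel (i j k l : Fin (m + n)) (x y : ℂ) :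
    (x - y) • (evalT s p i j x * evalT s p k l y -
        commSign s i j k l • (evalT s p k l y * evalT s p i j x)) =
      relSign s i j k •
        (evalT s p k j x * evalT s p i l y - evalT s p k j y * evalT s p i l x) := by
  have hb : evalT s p i j x * evalT s p k l y -
      commSign s i j k l • (evalT s p k l y * evalT s p i j x) =
      vecEval p (fun r => vecEval p (fun q => bracket s p i j r k l q) y) x := by
    unfold evalT bracket
    rw [vecEval_mul_vecEval, vecEval_mul_vecEval' p (t s p i j) (t s p k l) x y]
    simp only [vecEval_sub, vecEval_smul]
  have hx : x • vecEval p (fun r => vecEval p (fun q => bracket s p i j r k l q) y) x =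
      vecEval p (fun r => vecEval p (fun q => bracket s p i j (r + 1) k l q) y) x := by
    refine (vecEval_shift (c := fun r => vecEval p (fun q => bracket s p i j r k l q) y)
      ?_ ?_ x).symm
    · simp [bracket_zero_left, vecEval]
    · simp [bracket, t_eq_zero s p i j (Nat.lt_succ_self p), vecEval]
  have hy : y • vecEval p (fun r => vecEval p (fun q => bracket s p i j r k l q) y) x =
      vecEval p (fun r => vecEval p (fun q => bracket s p i j r k l (q + 1)) y) x := by
    rw [← vecEval_smul]
    congr 1
    funext r
    refine (vecEval_shift (c := fun q => bracket s p i j r k l q) ?_ ?_ y).symm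
    · simp [bracket_zero_right]
    · simp [bracket, t_eq_zero s p k l (Nat.lt_succ_self p)]
  rw [hb, sub_smul, hx, hy]
  simp only [← vecEval_sub, bracket_rel]
  simp only [vecEval_smul, vecEval_sub]
  unfold evalT
  rw [vecEval_mul_vecEval, vecEval_mul_vecEval' p (t s p i l) (t s p k j) x y]

/-- The element `-∑_a (-1)^{s_a} a t_{aa}^{(1)}`, whose adjoint action gives `t_{cd}^{(r)}` the
degree `d - c`. -/
def gradingElement : LevelYangian s p :=
  ∑ b : Fin (m + n), (-(paritySign (s.term b)) * ((b : ℕ) : ℂ)) • t s p b b 1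

theorem gradingElement_comm (c d : Fin (m + n)) (q : ℕ) :
    gradingElement s p * t s p c d q - t s p c d q * gradingElement s p =
      (((d : ℕ) : ℂ) - ((c : ℕ) : ℂ)) • t s p c d q := by
  have h : ∀ b : Fin (m + n), t s p b b 1 * t s p c d q - t s p c d q * t s p b b 1 =
      paritySign (s.term b) • ((if c = b then t s p c d q else 0) -
        if b = d then t s p c d q else 0) := by
    intro b
    have h1 := bracket_rel s p b b c d 0 q
    rw [bracket_zero_left, sub_zero, relSign_self, t_zero, t_zero, bracket, commSign_self,
      one_smul, zero_add] at h1
    rw [h1]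
    congr 2
    · split_ifs with h
      · rw [h, one_mul]
      · rw [zero_mul]
    · split_ifs with h
      · rw [h, mul_one]
      · rw [mul_zero]
  have h2 : ∀ b : Fin (m + n),
      (-(paritySign (s.term b)) * ((b : ℕ) : ℂ)) • t s p b b 1 * t s p c d q -
        t s p c d q * ((-(paritySign (s.term b)) * ((b : ℕ) : ℂ)) • t s p b b 1) =
      (if b = d then ((b : ℕ) : ℂ) • t s p c d q else 0) -
        (if c = b then ((b : ℕ) : ℂ) • t s p c d q else 0) := by
    intro b
    rw [smul_mul_assoc, mul_smul_comm, ← smul_sub, h, smul_smul]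
    have h3 : -(paritySign (s.term b)) * ((b : ℕ) : ℂ) * paritySign (s.term b) =
        -((b : ℕ) : ℂ) := by
      linear_combination (-((b : ℕ) : ℂ)) * paritySign_mul_self (s.term b)
    rw [h3]
    split_ifs <;> simp
  unfold gradingElement
  rw [Finset.sum_mul, Finset.mul_sum, ← Finset.sum_sub_distrib]
  simp only [h2, Finset.sum_sub_distrib, Finset.sum_ite_eq, Finset.sum_ite_eq', Finset.mem_univ,
    if_true, sub_smul]

end LevelYangian

namespace LevelYangian

/-! ### Triangular decomposition and highest weight modules -/

section Modules

variable {m n : ℕ} {s : ParitySequence m n} {p : ℕ}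
variable {V : Type*} [AddCommGroup V] [Module ℂ V] [Module (LevelYangian s p) V]

/-- The level Yangian is generated by the elements `t_{ij}^{(r)}`. -/
theorem induction_t {P : LevelYangian s p → Prop} (halg : ∀ c : ℂ, P (algebraMap ℂ _ c))
    (ht : ∀ i j r, P (t s p i j r)) (hadd : ∀ x y, P x → P y → P (x + y))
    (hmul : ∀ x y, P x → P y → P (x * y)) (y : LevelYangian s p) : P y := by
  obtain ⟨y, rfl⟩ : ∃ x, mk s p x = y := RingQuot.mkAlgHom_surjective ℂ _ y
  obtain ⟨y, rfl⟩ : ∃ x, Yangian.mk s x = y := RingQuot.mkAlgHom_surjective ℂ _ y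
  induction y using FreeAlgebra.induction with
  | grade0 c => rw [AlgHom.commutes, AlgHom.commutes]; exact halg c
  | grade1 x => exact ht x.1 x.2.1 (x.2.2 + 1)
  | mul x y hx hy => rw [map_mul, map_mul]; exact hmul _ _ hx hy
  | add x y hx hy => rw [map_add, map_add]; exact hadd _ _ hx hy

/-- The vectors `t_{c_1 d_1}^{(q_1)} ⋯ t_{c_l d_l}^{(q_l)} v` with all `c_a > d_a` and `v ∈ E`,
together with their degree `∑ (c_a - d_a)`. -/
inductive LoweringWord (E : Submodule ℂ V) : ℕ → V → Prop
  | base {v : V} (hv : v ∈ E) : LoweringWord E 0 v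
  | lower {k : ℕ} {v : V} {c d : Fin (m + n)} (h : d < c) (q : ℕ) (hv : LoweringWord E k v) :
      LoweringWord E (k + ((c : ℕ) - (d : ℕ))) (t s p c d q • v)

variable (s p) in
/-- The span of the lowering words of degree `z`, which is zero if `z` is negative. -/
def loweringSpan (E : Submodule ℂ V) (z : ℤ) : Submodule ℂ V :=
  Submodule.span ℂ {v | ∃ k : ℕ, (k : ℤ) = z ∧ LoweringWord (s := s) (p := p) E k v}

variable {E : Submodule ℂ V}

theorem loweringSpan_zero_le : loweringSpan s p E 0 ≤ E := by
  refine Submodule.span_le.2 ?_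
  rintro v ⟨k, hk, hv⟩
  cases hv with
  | base hv => exact hv
  | @lower k v c d hdc q hv =>
    have : (d : ℕ) < (c : ℕ) := hdc
    omega

variable [IsScalarTower ℂ (LevelYangian s p) V]

theorem smul_mem_of_eq_span {U W : Submodule ℂ V} (y : LevelYangian s p) {S : Set V}
    (hU : U = Submodule.span ℂ S) (h : ∀ v ∈ S, y • v ∈ W) {v : V} (hv : v ∈ U) : y • v ∈ W := by
  subst hU
  induction hv using Submodule.span_induction with
  | mem v hv => exact h v hv
  | zero => rw [smul_zero]; exact W.zero_mem
  | add v w _ _ hv hw => rw [smul_add]; exact W.add_mem hv hw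
  | smul c v _ hv => rw [smul_comm]; exact W.smul_mem c hv

theorem lower_smul_mem {c d : Fin (m + n)} (h : d < c) (q : ℕ) {z : ℤ} {v : V}
    (hv : v ∈ loweringSpan s p E z) :
    t s p c d q • v ∈ loweringSpan s p E (z + (c : ℕ) - (d : ℕ)) := by
  refine smul_mem_of_eq_span _ rfl (fun v hv => ?_) hv
  obtain ⟨k, rfl, hw⟩ := hv
  refine Submodule.subset_span ⟨_, ?_, .lower h q hw⟩
  have h' : (d : ℕ) < (c : ℕ) := h
  omega

theorem smul_mem_of_mem_span {U : Submodule ℂ V} {S : Set (LevelYangian s p)} {v : V}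
    (h : ∀ y ∈ S, y • v ∈ U) {y : LevelYangian s p} (hy : y ∈ Submodule.span ℂ S) : y • v ∈ U := by
  induction hy using Submodule.span_induction with
  | mem y hy => exact h y hy
  | zero => rw [zero_smul]; exact U.zero_mem
  | add x y _ _ hx hy => rw [add_smul]; exact U.add_mem hx hy
  | smul c y _ hy => rw [smul_assoc]; exact U.smul_mem c hy

/-- The operator `t_{ab}^{(r)}` takes a lowering word of degree `k` to a combination of lowering words
of degree `k + a - b`. The induction on `k` replaces an ordering of the generators. -/
theorem t_smul_loweringWord (hraise : ∀ a b, a < b → ∀ r, ∀ v ∈ E, t s p a b r • v = 0)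
    (hdiag : ∀ a r, ∀ v ∈ E, t s p a a r • v ∈ E) (k : ℕ) :
    ∀ v, LoweringWord (s := s) (p := p) E k v → ∀ (a b : Fin (m + n)) (r : ℕ),
      t s p a b r • v ∈ loweringSpan s p E ((k : ℤ) + (a : ℕ) - (b : ℕ)) := by
  induction k using Nat.strong_induction_on with
  | _ k ih =>
    have ih' : ∀ z : ℤ, z < k → ∀ v ∈ loweringSpan s p E z, ∀ (a b : Fin (m + n)) (r : ℕ),
        t s p a b r • v ∈ loweringSpan s p E (z + (a : ℕ) - (b : ℕ)) := by
      intro z hz v hv a b r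
      refine smul_mem_of_eq_span _ rfl (fun v hv => ?_) hv
      obtain ⟨k', rfl, hw⟩ := hv
      exact ih k' (by omega) v hw a b r
    intro v hv a b r
    rcases lt_or_ge b a with hba | hab
    · exact lower_smul_mem hba r (Submodule.subset_span ⟨k, rfl, hv⟩)
    cases hv with
    | base hv =>
      rcases hab.eq_or_lt with rfl | hab
      · refine Submodule.subset_span ⟨0, by omega, .base (hdiag _ _ _ hv)⟩
      · rw [hraise a b hab r v hv]
        exact Submodule.zero_mem _
    | @lower k v c d hdc q hv =>
      have hdc' : (d : ℕ) < (c : ℕ) := hdc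
      have hv' : v ∈ loweringSpan s p E k := Submodule.subset_span ⟨k, rfl, hv⟩
      have hk : (k : ℤ) < ((k + ((c : ℕ) - (d : ℕ)) : ℕ) : ℤ) := by omega
      have hsplit : t s p a b r • t s p c d q • v =
          commSign s a b c d • t s p c d q • t s p a b r • v + bracket s p a b r c d q • v := by
        rw [bracket, sub_smul, smul_assoc, mul_smul, mul_smul]
        abel
      rw [hsplit]
      refine Submodule.add_mem _ (Submodule.smul_mem _ _ ?_) ?_
      · have h := lower_smul_mem hdc q (ih' k hk v hv' a b r)
        convert h using 2
        omega
      -- the two expressions of the super-commutator are used to keep the degrees below `k`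
      rcases lt_or_ge b c with hbc | hcb
      · refine smul_mem_of_mem_span ?_ (bracket_mem_span s p a b r c d q)
        rintro _ ⟨x, rfl⟩
        have h := lower_smul_mem hbc x.1 (ih' k hk v hv' a d x.2)
        rw [mul_smul]
        convert h using 2
        omega
      · refine smul_mem_of_mem_span ?_ (bracket_mem_span' s p a b r c d q)
        rintro _ ⟨x, rfl⟩
        have hcb' : (c : ℕ) ≤ (b : ℕ) := hcb
        have h := ih' _ (by omega) _ (ih' k hk v hv' c b x.2) a d x.1
        rw [mul_smul]
        convert h using 2
        omega

/-- A space of vectors that is annihilated by the raising operators and stable under the diagonal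
ones generates a submodule spanned by lowering words. -/
theorem smul_mem_iSup_loweringSpan
    (hraise : ∀ a b, a < b → ∀ r, ∀ v ∈ E, t s p a b r • v = 0)
    (hdiag : ∀ a r, ∀ v ∈ E, t s p a a r • v ∈ E) (y : LevelYangian s p) {v : V} (hv : v ∈ E) :
    y • v ∈ ⨆ z, loweringSpan s p E z := by
  have key : ∀ v ∈ ⨆ z, loweringSpan s p E z, y • v ∈ ⨆ z, loweringSpan s p E z := by
    induction y using induction_t with
    | halg c => intro v hv; rw [algebraMap_smul]; exact Submodule.smul_mem _ c hv
    | ht i j r =>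
      intro v hv
      induction hv using Submodule.iSup_induction' with
      | mem z v hv =>
        refine smul_mem_of_eq_span _ rfl (fun v hv => ?_) hv
        obtain ⟨k, rfl, hw⟩ := hv
        exact Submodule.mem_iSup_of_mem _ (t_smul_loweringWord hraise hdiag k v hw i j r)
      | zero => rw [smul_zero]; exact Submodule.zero_mem _
      | add v w _ _ hv hw => rw [smul_add]; exact Submodule.add_mem _ hv hw
    | hadd x y hx hy =>
      intro v hv; rw [add_smul]; exact Submodule.add_mem _ (hx v hv) (hy v hv)
    | hmul x y hx hy => intro v hv; rw [mul_smul]; exact hx _ (hy v hv)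
  exact key v (Submodule.mem_iSup_of_mem 0 (Submodule.subset_span ⟨0, rfl, .base hv⟩))

theorem gradingElement_smul_t {c d : Fin (m + n)} (q : ℕ) {μ : ℂ} {v : V}
    (hv : gradingElement s p • v = μ • v) :
    gradingElement s p • t s p c d q • v =
      (μ + ((d : ℕ) : ℂ) - ((c : ℕ) : ℂ)) • t s p c d q • v := by
  have h := congrArg (· • v) (gradingElement_comm s p c d q)
  simp only [sub_smul, mul_smul, hv, smul_assoc] at h
  rw [smul_comm (t s p c d q) μ v] at h
  rw [sub_eq_iff_eq_add] at h
  rw [h, sub_smul, add_smul]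
  abel

theorem gradingElement_smul_loweringWord {μ : ℂ}
    (hE : ∀ v ∈ E, gradingElement s p • v = μ • v) {k : ℕ} {v : V}
    (hv : LoweringWord (s := s) (p := p) E k v) : gradingElement s p • v = (μ - k) • v := by
  induction hv with
  | base hv => rw [hE _ hv, Nat.cast_zero, sub_zero]
  | @lower k v c d hdc q hv ih =>
    rw [gradingElement_smul_t q ih, Nat.cast_add, Nat.cast_sub (le_of_lt hdc)]
    congr 1
    ring

variable (V s p) in
/-- The sum of the generalized eigenspaces of the grading element for the eigenvalues different from
`ν`: the vectors annihilated by some polynomial in this element that does not vanish at `ν`. -/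
def awayFrom (ν : ℂ) : Submodule ℂ V where
  carrier := {v | ∃ q : ℂ[X], q.eval ν ≠ 0 ∧ aeval (gradingElement s p) q • v = 0}
  add_mem' := by
    rintro v w ⟨q, hq, hv⟩ ⟨q', hq', hw⟩
    refine ⟨q * q', by rw [eval_mul]; exact mul_ne_zero hq hq', ?_⟩
    have h1 : aeval (gradingElement s p) (q * q') • v = 0 := by
      rw [mul_comm, map_mul, mul_smul, hv, smul_zero]
    rw [smul_add, h1, map_mul, mul_smul, hw, smul_zero, add_zero]
  zero_mem' := ⟨1, by simp, by simp⟩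
  smul_mem' := by
    rintro c v ⟨q, hq, hv⟩
    exact ⟨q, hq, by rw [smul_comm, hv, smul_zero]⟩

theorem aeval_gradingElement_smul {μ : ℂ} {v : V} (hv : gradingElement s p • v = μ • v)
    (q : ℂ[X]) : aeval (gradingElement s p) q • v = q.eval μ • v := by
  induction q using Polynomial.induction_on' with
  | add q q' hq hq' => rw [map_add, add_smul, hq, hq', eval_add, add_smul]
  | monomial k c =>
    rw [aeval_monomial, eval_monomial, mul_smul, mul_smul, algebraMap_smul]
    congr 1
    induction k with
    | zero => simp
    | succ k ih => rw [pow_succ', mul_smul, ih, smul_comm, hv, smul_smul, pow_succ]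

theorem mem_awayFrom {μ ν : ℂ} (h : μ ≠ ν) {v : V} (hv : gradingElement s p • v = μ • v) :
    v ∈ awayFrom s p V ν := by
  refine ⟨X - C μ, by simpa [sub_eq_zero] using h.symm, ?_⟩
  rw [aeval_gradingElement_smul hv]
  simp

theorem notMem_awayFrom {μ : ℂ} {v : V} (hv : gradingElement s p • v = μ • v) (h0 : v ≠ 0) :
    v ∉ awayFrom s p V μ := by
  rintro ⟨q, hq, h⟩
  rw [aeval_gradingElement_smul hv] at h
  exact (smul_ne_zero hq h0) h

theorem loweringSpan_le_awayFrom {μ ν : ℂ} (hE : ∀ v ∈ E, gradingElement s p • v = μ • v) {z : ℤ}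
    (hz : 0 ≤ z → μ - z ≠ ν) : loweringSpan s p E z ≤ awayFrom s p V ν := by
  refine Submodule.span_le.2 ?_
  rintro v ⟨k, rfl, hv⟩
  refine mem_awayFrom (hz (Int.natCast_nonneg k)) ?_
  simpa using gradingElement_smul_loweringWord hE hv

/-- In a simple module with a nonzero vector of degree `ν`, a space of singular vectors of degree `μ`
which is stable under the diagonal operators is zero unless `μ - ν` is a natural number: lowering
words cannot lead from it to the degree `ν`. -/
theorem eq_bot_of_singular [IsSimpleModule (LevelYangian s p) V] {ζ : V} (hζ : ζ ≠ 0) {μ ν : ℂ}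
    (hν : gradingElement s p • ζ = ν • ζ) (hμν : ∀ k : ℕ, μ - k ≠ ν)
    (hE : ∀ v ∈ E, gradingElement s p • v = μ • v)
    (hraise : ∀ a b, a < b → ∀ r, ∀ v ∈ E, t s p a b r • v = 0)
    (hdiag : ∀ a r, ∀ v ∈ E, t s p a a r • v ∈ E) : E = ⊥ := by
  refine (Submodule.eq_bot_iff _).2 fun v hv => ?_
  by_contra hv0
  obtain ⟨y, hy⟩ := IsSimpleModule.toSpanSingleton_surjective (LevelYangian s p) hv0 ζ
  rw [LinearMap.toSpanSingleton_apply] at hy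
  refine notMem_awayFrom hν hζ ?_
  rw [← hy]
  refine (iSup_le fun z => loweringSpan_le_awayFrom hE fun hz => ?_)
    (smul_mem_iSup_loweringSpan hraise hdiag y hv)
  lift z to ℕ using hz
  simpa using hμν z

theorem evalT_smul (i j : Fin (m + n)) (x : ℂ) (v : V) :
    evalT s p i j x • v = vecEval p (fun r => t s p i j r • v) x := by
  simp [evalT, vecEval, Finset.sum_smul]

theorem t_smul_mem_of_evalT {i j : Fin (m + n)} {v : V} {U : Submodule ℂ V}
    (h : ∀ x, evalT s p i j x • v ∈ U) (r : ℕ) : t s p i j r • v ∈ U := by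
  rcases lt_or_ge p r with hr | hr
  · rw [t_eq_zero s p i j hr, zero_smul]
    exact U.zero_mem
  · refine coeff_mem_of_infinite (p := p) (c := fun r => t s p i j r • v) ?_ hr
    simp only [← evalT_smul, h]
    exact Set.infinite_univ

theorem t_smul_eq_zero_of_evalT {i j : Fin (m + n)} {v : V}
    (h : ∀ x, evalT s p i j x • v = 0) (r : ℕ) : t s p i j r • v = 0 := by
  simpa using t_smul_mem_of_evalT (U := ⊥) (by simpa using h) r

variable (s p) in
/-- The vector `v` is annihilated by all `T_{ij}(u)` with `i < j`, and `T_{ii}(u) v = λ_i(u) v`. -/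
structure IsHighest (lam : Fin (m + n) → ℂ[X]) (v : V) : Prop where
  raise : ∀ i j, i < j → ∀ x, evalT s p i j x • v = 0
  diag : ∀ i x, evalT s p i i x • v = (lam i).eval x • v

theorem eval_smul_eq_zero_iff (q : (LevelYangian s p)[X]) (v : V) :
    (∀ x : ℂ, q.eval (algebraMap ℂ _ x) • v = 0) ↔ ∀ d, q.coeff d • v = 0 := by
  have h : ∀ x : ℂ, q.eval (algebraMap ℂ _ x) • v =
      vecEval q.natDegree (fun r => q.coeff (q.natDegree - r) • v) x := by
    intro x
    rw [vecEval, eval_eq_sum_range, Finset.sum_smul, ← Finset.sum_range_reflect]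
    refine Finset.sum_congr rfl fun r hr => ?_
    rw [Nat.add_sub_cancel, ← map_pow, ← Algebra.commutes, mul_smul, algebraMap_smul]
  simp only [h]
  constructor
  · intro h0 d
    rcases lt_or_ge q.natDegree d with hd | hd
    · rw [coeff_eq_zero_of_natDegree_lt hd, zero_smul]
    · have := coeff_eq_zero_of_vecEval h0 (Nat.sub_le q.natDegree d)
      rwa [Nat.sub_sub_self hd] at this
  · intro h0 x
    simp [vecEval, h0]

theorem eval_T (i j : Fin (m + n)) (x : ℂ) :
    (T s p i j).eval (algebraMap ℂ _ x) = evalT s p i j x := by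
  simp only [T, evalT, vecEval, eval_finsetSum, eval_monomial]
  refine Finset.sum_congr rfl fun r _ => ?_
  rw [← map_pow, ← Algebra.commutes, Algebra.smul_def]

theorem isHighest_iff (lam : Fin (m + n) → ℂ[X]) (v : V) :
    IsHighest s p lam v ↔ ∀ y ∈ vermaIdeal s p lam, y • v = 0 := by
  have hdiag : ∀ i (x : ℂ),
      (T s p i i - (lam i).map (algebraMap ℂ (LevelYangian s p))).eval (algebraMap ℂ _ x) • v =
        evalT s p i i x • v - (lam i).eval x • v := by
    intro i x
    rw [eval_sub, eval_T, eval_map_apply, sub_smul, algebraMap_smul]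
  constructor
  · intro h y hy
    have hle : vermaIdeal s p lam ≤
        LinearMap.ker (LinearMap.toSpanSingleton (LevelYangian s p) V v) := by
      refine Submodule.span_le.2 ?_
      rintro y (⟨i, j, d, hij, rfl⟩ | ⟨i, d, rfl⟩)
      · refine LinearMap.mem_ker.2 ((eval_smul_eq_zero_iff (T s p i j) v).1 (fun x => ?_) d)
        rw [eval_T, h.raise i j hij]
      · refine LinearMap.mem_ker.2 ((eval_smul_eq_zero_iff (T s p i i -
          (lam i).map (algebraMap ℂ (LevelYangian s p))) v).1 (fun x => ?_) d)
        rw [hdiag, h.diag, sub_self]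
    exact hle hy
  · intro h
    refine ⟨fun i j hij x => ?_, fun i x => sub_eq_zero.1 ?_⟩
    · rw [← eval_T]
      exact (eval_smul_eq_zero_iff _ v).2
        (fun d => h _ (Submodule.subset_span (Or.inl ⟨i, j, d, hij, rfl⟩))) x
    · rw [← hdiag]
      exact (eval_smul_eq_zero_iff _ v).2
        (fun d => h _ (Submodule.subset_span (Or.inr ⟨i, d, rfl⟩))) x

theorem IsHighest.t_mem_span {lam : Fin (m + n) → ℂ[X]} {v : V} (h : IsHighest s p lam v)
    (i : Fin (m + n)) (r : ℕ) : t s p i i r • v ∈ Submodule.span ℂ {v} := by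
  refine t_smul_mem_of_evalT (fun x => ?_) r
  rw [h.diag]
  exact Submodule.smul_mem _ _ (Submodule.mem_span_singleton_self v)

theorem IsHighest.exists_degree {lam : Fin (m + n) → ℂ[X]} {v : V} (h : IsHighest s p lam v) :
    ∃ μ : ℂ, gradingElement s p • v = μ • v := by
  have : gradingElement s p • v ∈ Submodule.span ℂ {v} := by
    rw [gradingElement, Finset.sum_smul]
    refine Submodule.sum_mem _ fun b _ => ?_
    rw [smul_assoc]
    exact Submodule.smul_mem _ _ (h.t_mem_span b 1)
  exact (Submodule.mem_span_singleton.1 this).imp fun μ h => h.symm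

/-- A proper submodule of a module generated by a highest vector of degree `μ` has no component of
degree `μ`. -/
theorem IsHighest.le_awayFrom {lam : Fin (m + n) → ℂ[X]} {v : V} (h : IsHighest s p lam v)
    (hgen : ∀ w : V, ∃ y : LevelYangian s p, y • v = w) {μ : ℂ}
    (hμ : gradingElement s p • v = μ • v) {N : Submodule (LevelYangian s p) V} (hN : N ≠ ⊤)
    {w : V} (hw : w ∈ N) : w ∈ awayFrom s p V μ := by
  obtain ⟨y, rfl⟩ := hgen w
  have hE : ∀ u ∈ Submodule.span ℂ {v}, gradingElement s p • u = μ • u := by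
    intro u hu
    obtain ⟨c, rfl⟩ := Submodule.mem_span_singleton.1 hu
    rw [smul_comm, hμ, smul_comm]
  have hmem : y • v ∈ ⨆ z, loweringSpan s p (Submodule.span ℂ {v}) z := by
    refine smul_mem_iSup_loweringSpan (fun a b hab r u hu => ?_) (fun a r u hu => ?_) y
      (Submodule.mem_span_singleton_self v)
    · obtain ⟨c, rfl⟩ := Submodule.mem_span_singleton.1 hu
      rw [smul_comm, t_smul_eq_zero_of_evalT (h.raise a b hab), smul_zero]
    · obtain ⟨c, rfl⟩ := Submodule.mem_span_singleton.1 hu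
      rw [smul_comm]
      exact Submodule.smul_mem _ _ (h.t_mem_span a r)
  have hle : ⨆ z, loweringSpan s p (Submodule.span ℂ {v}) z ≤
      Submodule.span ℂ {v} ⊔ awayFrom s p V μ := by
    refine iSup_le fun z => ?_
    rcases eq_or_ne z 0 with rfl | hz
    · exact loweringSpan_zero_le.trans le_sup_left
    · refine (loweringSpan_le_awayFrom hE fun _ h => hz ?_).trans le_sup_right
      simpa using h
  obtain ⟨u, hu, w, hw', huw⟩ := Submodule.mem_sup.1 (hle hmem)
  obtain ⟨c, rfl⟩ := Submodule.mem_span_singleton.1 hu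
  rcases eq_or_ne c 0 with rfl | hc
  · rwa [← huw, zero_smul, zero_add]
  -- a polynomial in the grading element isolates the component of degree `μ`
  refine absurd (Submodule.eq_top_iff'.2 fun w' => ?_) hN
  obtain ⟨q, hq, hqw⟩ := hw'
  have hv : v ∈ N := by
    have h1 := N.smul_mem (aeval (gradingElement s p) q) hw
    rw [← huw, smul_add, hqw, add_zero, smul_comm, aeval_gradingElement_smul hμ, smul_smul] at h1
    have h2 := N.smul_mem (algebraMap ℂ (LevelYangian s p) (c * q.eval μ)⁻¹) h1
    rwa [algebraMap_smul, smul_smul, inv_mul_cancel₀ (mul_ne_zero hc hq), one_smul] at h2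
  obtain ⟨y', rfl⟩ := hgen w'
  exact N.smul_mem y' hv

end Modules

variable {m n : ℕ} {s : ParitySequence m n} {p : ℕ}

theorem isHighest_verma (lam : Fin (m + n) → ℂ[X]) :
    IsHighest s p lam (Submodule.Quotient.mk 1 : Verma s p lam) := by
  refine (isHighest_iff lam _).2 fun y hy => ?_
  rw [← Submodule.Quotient.mk_smul, smul_eq_mul, mul_one]
  exact (Submodule.Quotient.mk_eq_zero _).2 hy

theorem verma_generated (lam : Fin (m + n) → ℂ[X]) (w : Verma s p lam) :
    ∃ y : LevelYangian s p, y • (Submodule.Quotient.mk 1 : Verma s p lam) = w := by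
  obtain ⟨y, rfl⟩ := Submodule.Quotient.mk_surjective _ w
  exact ⟨y, by rw [← Submodule.Quotient.mk_smul, smul_eq_mul, mul_one]⟩

theorem isCoatom_maxSubmodule (lam : Fin (m + n) → ℂ[X]) [Nontrivial (Verma s p lam)] :
    IsCoatom (maxSubmodule s p lam) := by
  have hle : ∀ N : Submodule (LevelYangian s p) (Verma s p lam), N ≠ ⊤ →
      N ≤ maxSubmodule s p lam := fun N hN => le_sSup hN
  refine ⟨fun htop => ?_, fun N hN => by_contra fun h => (hN.not_ge (hle N h))⟩
  have hv := isHighest_verma (s := s) (p := p) lam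
  obtain ⟨μ, hμ⟩ := hv.exists_degree
  have h0 : (Submodule.Quotient.mk 1 : Verma s p lam) ≠ 0 := by
    intro h0
    obtain ⟨w, hw⟩ := exists_ne (0 : Verma s p lam)
    obtain ⟨y, hy⟩ := verma_generated lam w
    rw [h0, smul_zero] at hy
    exact hw hy.symm
  refine notMem_awayFrom hμ h0 ?_
  have hmem : (Submodule.Quotient.mk 1 : Verma s p lam) ∈ maxSubmodule s p lam := by
    rw [htop]; exact Submodule.mem_top
  rw [maxSubmodule, sSup_eq_iSup'] at hmem
  generalize (Submodule.Quotient.mk 1 : Verma s p lam) = u at hmem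
  induction hmem using Submodule.iSup_induction' with
  | mem N w hw => exact hv.le_awayFrom (verma_generated lam) hμ N.2 hw
  | zero => exact Submodule.zero_mem _
  | add v w _ _ hv hw => exact Submodule.add_mem _ hv hw

theorem isSimpleModule_L (lam : Fin (m + n) → ℂ[X]) [Nontrivial (Verma s p lam)] :
    IsSimpleModule (LevelYangian s p) (L s p lam) :=
  isSimpleModule_iff_isCoatom.2 (isCoatom_maxSubmodule lam)

theorem exists_isHighest_L (lam : Fin (m + n) → ℂ[X]) [Nontrivial (Verma s p lam)] :
    ∃ v : L s p lam, v ≠ 0 ∧ IsHighest s p lam v := by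
  refine ⟨Submodule.Quotient.mk (Submodule.Quotient.mk 1), fun h0 => ?_,
    (isHighest_iff lam _).2 fun y hy => ?_⟩
  · refine (isCoatom_maxSubmodule (s := s) (p := p) lam).1 (Submodule.eq_top_iff'.2 fun w => ?_)
    obtain ⟨y, rfl⟩ := verma_generated lam w
    exact Submodule.smul_mem _ y ((Submodule.Quotient.mk_eq_zero _).1 h0)
  · rw [← Submodule.Quotient.mk_smul, (isHighest_iff lam _).1 (isHighest_verma lam) y hy]
    rfl

theorem nontrivial_verma {V : Type*} [AddCommGroup V] [Module ℂ V] [Module (LevelYangian s p) V]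
    [IsScalarTower ℂ (LevelYangian s p) V] {lam : Fin (m + n) → ℂ[X]} {v : V} (hv : v ≠ 0)
    (h : IsHighest s p lam v) : Nontrivial (Verma s p lam) := by
  refine Submodule.Quotient.nontrivial_iff.2 fun htop => hv ?_
  have := (isHighest_iff lam v).1 h 1 (by rw [htop]; exact Submodule.mem_top)
  rwa [one_smul] at this

/-- A simple module with a highest vector of weight `λ(u)` is isomorphic to `L(λ(u))`. -/
theorem nonempty_equiv_L {V : Type*} [AddCommGroup V] [Module ℂ V] [Module (LevelYangian s p) V]
    [IsScalarTower ℂ (LevelYangian s p) V] [IsSimpleModule (LevelYangian s p) V]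
    {lam : Fin (m + n) → ℂ[X]} {v : V} (hv : v ≠ 0) (h : IsHighest s p lam v) :
    Nonempty (V ≃ₗ[LevelYangian s p] L s p lam) := by
  have := nontrivial_verma hv h
  let g : Verma s p lam →ₗ[LevelYangian s p] V :=
    (vermaIdeal s p lam).liftQ (LinearMap.toSpanSingleton _ V v) ((isHighest_iff lam v).1 h)
  have hg : Function.Surjective g := by
    intro w
    obtain ⟨y, hy⟩ := IsSimpleModule.toSpanSingleton_surjective (LevelYangian s p) hv w
    exact ⟨Submodule.Quotient.mk y, hy⟩
  have hker : LinearMap.ker g ≠ ⊤ := by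
    intro htop
    have h1 : g (Submodule.Quotient.mk 1) = v := by
      change (1 : LevelYangian s p) • v = v
      rw [one_smul]
    refine hv (h1.symm.trans (LinearMap.mem_ker.1 ?_))
    rw [htop]; exact Submodule.mem_top
  have : IsSimpleModule (LevelYangian s p) (Verma s p lam ⧸ LinearMap.ker g) :=
    IsSimpleModule.congr (g.quotKerEquivOfSurjective hg)
  have heq : LinearMap.ker g = maxSubmodule s p lam :=
    ((isSimpleModule_iff_isCoatom.1 this).le_iff.1 (le_sSup hker)).resolve_left
      (isCoatom_maxSubmodule lam).1 |>.symm
  exact ⟨(g.quotKerEquivOfSurjective hg).symm.trans (Submodule.quotEquivOfEq _ _ heq)⟩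

end LevelYangian

/-! ### The odd rank two case -/

theorem infinite_eval_ne_zero {q : ℂ[X]} (hq : q ≠ 0) : {y : ℂ | q.eval y ≠ 0}.Infinite := by
  refine (infinite_compl_finset q.roots.toFinset).mono fun y hy => ?_
  simpa [hq] using hy

theorem isCoprime_X_sub_C_of_eval_ne_zero {g : ℂ[X]} {y : ℂ} (h : g.eval y ≠ 0) :
    IsCoprime g (X - C y) := by
  refine ((irreducible_X_sub_C y).coprime_iff_not_dvd.2 fun hd => h ?_).symm
  exact dvd_iff_isRoot.1 hd

/-- Operators `A(x)`, `B(x)`, `C(x)`, `D(x)` on `V`, of which `A`, `C` and `D` are polynomials in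
`x` of degree at most `p` with coefficients `a`, `c` and `d`, that satisfy those relations of the
Yangian of level `p` of `gl_{1|1}`, with parity sequence `01`, which are needed below. Here `A`,
`B`, `C`, `D` stand for `T_{11}`, `T_{12}`, `T_{21}`, `T_{22}`. -/
structure OddPair (p : ℕ) (V : Type*) [AddCommGroup V] [Module ℂ V] where
  /-- the coefficients of `A` -/
  a : ℕ → Module.End ℂ V
  /-- the values of `B` -/
  B : ℂ → Module.End ℂ V
  /-- the coefficients of `C` -/
  c : ℕ → Module.End ℂ V
  /-- the coefficients of `D` -/
  d : ℕ → Module.End ℂ V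
  a_zero : a 0 = 1
  c_zero : c 0 = 0
  d_zero : d 0 = 1
  rel_AA : ∀ x y v, vecEval p a x (vecEval p a y v) = vecEval p a y (vecEval p a x v)
  rel_AC : ∀ x y v, (x - y) • vecEval p a x (vecEval p c y v) =
    (x - y - 1) • vecEval p c y (vecEval p a x v) + vecEval p c x (vecEval p a y v)
  rel_DC : ∀ x y v, (x - y) • vecEval p d x (vecEval p c y v) =
    (x - y - 1) • vecEval p c y (vecEval p d x v) + vecEval p c x (vecEval p d y v)
  rel_BC : ∀ x y v, (x - y) • (B x (vecEval p c y v) + vecEval p c y (B x v)) =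
    vecEval p d y (vecEval p a x v) - vecEval p d x (vecEval p a y v)
  rel_CC : ∀ x y v, (x - y + 1) • vecEval p c x (vecEval p c y v) =
    (y - x + 1) • vecEval p c y (vecEval p c x v)
  rel_AD : ∀ x y v, (x - y) • (vecEval p a x (vecEval p d y v) - vecEval p d y (vecEval p a x v)) =
    vecEval p c x (B y v) - vecEval p c y (B x v)

namespace OddPair

variable {p : ℕ} {V : Type*} [AddCommGroup V] [Module ℂ V] (R : OddPair p V)

/-- The operator `A(x)`. -/
def opA (x : ℂ) : Module.End ℂ V := vecEval p R.a x

/-- The operator `C(x)`. -/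
def opC (x : ℂ) : Module.End ℂ V := vecEval p R.c x

/-- The operator `D(x)`. -/
def opD (x : ℂ) : Module.End ℂ V := vecEval p R.d x

theorem opA_comm (x y : ℂ) (v : V) : R.opA x (R.opA y v) = R.opA y (R.opA x v) :=
  R.rel_AA x y v

theorem opA_opC (x y : ℂ) (v : V) : (x - y) • R.opA x (R.opC y v) =
    (x - y - 1) • R.opC y (R.opA x v) + R.opC x (R.opA y v) := R.rel_AC x y v

theorem opD_opC (x y : ℂ) (v : V) : (x - y) • R.opD x (R.opC y v) =
    (x - y - 1) • R.opC y (R.opD x v) + R.opC x (R.opD y v) := R.rel_DC x y v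

theorem opB_opC (x y : ℂ) (v : V) : (x - y) • (R.B x (R.opC y v) + R.opC y (R.B x v)) =
    R.opD y (R.opA x v) - R.opD x (R.opA y v) := R.rel_BC x y v

theorem opC_opC (x y : ℂ) (v : V) : (x - y + 1) • R.opC x (R.opC y v) =
    (y - x + 1) • R.opC y (R.opC x v) := R.rel_CC x y v

theorem opA_opD (x y : ℂ) (v : V) :
    (x - y) • (R.opA x (R.opD y v) - R.opD y (R.opA x v)) =
      R.opC x (R.B y v) - R.opC y (R.B x v) := R.rel_AD x y v

theorem opC_opC_sub_one (x : ℂ) (v : V) : R.opC x (R.opC (x - 1) v) = 0 := by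
  have h := R.opC_opC x (x - 1) v
  rw [show x - 1 - x + 1 = (0 : ℂ) by ring, zero_smul] at h
  refine (smul_eq_zero.1 h).resolve_left ?_
  norm_num

/-- The span of the vectors `C(x_1) ⋯ C(x_j) ζ`. -/
def words (ζ : V) : ℕ → Submodule ℂ V
  | 0 => Submodule.span ℂ {ζ}
  | j + 1 => ⨆ r : Fin (p + 1), (words ζ j).map (R.c r)

variable {R} {ζ : V}

theorem finiteDimensional_words (j : ℕ) : FiniteDimensional ℂ (R.words ζ j) := by
  induction j with
  | zero => exact inferInstanceAs (FiniteDimensional ℂ (Submodule.span ℂ {ζ}))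
  | succ j ih =>
    exact inferInstanceAs (FiniteDimensional ℂ
      (⨆ r : Fin (p + 1), (R.words ζ j).map (R.c r) : Submodule ℂ V))

theorem opC_mem_words {j : ℕ} {w : V} (hw : w ∈ R.words ζ j) (y : ℂ) :
    R.opC y w ∈ R.words ζ (j + 1) := by
  unfold opC
  rw [vecEval_apply]
  refine vecEval_mem (fun r hr => ?_) y
  exact Submodule.mem_iSup_of_mem (⟨r, Nat.lt_succ_of_le hr⟩ : Fin (p + 1))
    (Submodule.mem_map_of_mem hw)

theorem words_succ_le {j : ℕ} {U : Submodule ℂ V}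
    (h : ∀ w ∈ R.words ζ j, {y | R.opC y w ∈ U}.Infinite) : R.words ζ (j + 1) ≤ U := by
  refine iSup_le fun r => Submodule.map_le_iff_le_comap.2 fun w hw => ?_
  refine coeff_mem_of_infinite (p := p) (c := fun r => R.c r w) ?_ (Nat.le_of_lt_succ r.2)
  simpa only [opC, vecEval_apply] using h w hw

/-- To prove a linear condition on the words in the operators `C(y)`, one may add a letter `C(y)`
with `y` outside a finite set, which keeps clear of the poles of the commutation relations. -/
theorem words_induction (U : ℕ → Submodule ℂ V) (h0 : ζ ∈ U 0)
    (h : ∀ j, R.words ζ j ≤ U j → ∀ w ∈ R.words ζ j, ∃ S : Finset ℂ, ∀ y ∉ S,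
      R.opC y w ∈ U (j + 1)) (j : ℕ) : R.words ζ j ≤ U j := by
  induction j with
  | zero => exact (Submodule.span_singleton_le_iff_mem _ _).2 h0
  | succ j ih =>
    refine words_succ_le fun w hw => ?_
    obtain ⟨S, hS⟩ := h j ih w hw
    exact (infinite_compl_finset S).mono hS

theorem opA_mem_words {l₁ : ℂ[X]} (hA : ∀ x, R.opA x ζ = l₁.eval x • ζ) (x : ℂ) {j : ℕ} {w : V}
    (hw : w ∈ R.words ζ j) : R.opA x w ∈ R.words ζ j := by
  have hall : ∀ j, ∀ x, ∀ w ∈ R.words ζ j, R.opA x w ∈ R.words ζ j := by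
    intro j
    induction j with
    | zero =>
      intro x
      refine fun w hw => ?_
      obtain ⟨e, rfl⟩ := Submodule.mem_span_singleton.1 hw
      rw [map_smul, hA, smul_smul]
      exact Submodule.smul_mem _ _ (Submodule.mem_span_singleton_self ζ)
    | succ j ih =>
      intro x
      refine words_succ_le (U := (R.words ζ (j + 1)).comap (R.opA x)) fun w hw => ?_
      refine (infinite_compl_finset {x}).mono fun y hy => ?_
      have hxy : x - y ≠ 0 := sub_ne_zero.2 fun h => hy (by simp [h])
      rw [Set.mem_ofPred_eq, Submodule.mem_comap, ← Submodule.smul_mem_iff _ hxy, opA_opC]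
      exact Submodule.add_mem _ (Submodule.smul_mem _ _ (opC_mem_words (ih x w hw) y))
        (opC_mem_words (ih y w hw) x)
  exact hall j x w hw

/-- A shadow of the centrality of the Berezinian: on a highest weight module, `D(x - 1)` and
`A(x - 1)` become proportional after multiplication by `C(x)`. -/
theorem opC_opD_words {l₁ l₂ : ℂ[X]} (hA : ∀ x, R.opA x ζ = l₁.eval x • ζ)
    (hD : ∀ x, R.opD x ζ = l₂.eval x • ζ) (x : ℂ) {j : ℕ} {w : V} (hw : w ∈ R.words ζ j) :
    l₁.eval (x - 1) • R.opC x (R.opD (x - 1) w) = l₂.eval (x - 1) • R.opC x (R.opA (x - 1) w) := by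
  let Φ : Module.End ℂ V := l₁.eval (x - 1) • R.opC x ∘ₗ R.opD (x - 1) -
    l₂.eval (x - 1) • R.opC x ∘ₗ R.opA (x - 1)
  have hΦ : ∀ v, Φ v = l₁.eval (x - 1) • R.opC x (R.opD (x - 1) v) -
    l₂.eval (x - 1) • R.opC x (R.opA (x - 1) v) := fun v => rfl
  suffices R.words ζ j ≤ LinearMap.ker Φ from
    sub_eq_zero.1 ((hΦ w).symm.trans (LinearMap.mem_ker.1 (this hw)))
  refine words_induction (fun _ => LinearMap.ker Φ) ?_ (fun j ih w hw => ?_) j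
  · rw [LinearMap.mem_ker, hΦ, hA, hD, map_smul, map_smul, smul_smul, smul_smul, mul_comm, sub_self]
  refine ⟨{x - 1, x + 1}, fun y hy => ?_⟩
  have h1 : x - y - 1 ≠ 0 := fun h => hy (by
    simp [show y = x - 1 by linear_combination -h])
  have h2 : x - y + 1 ≠ 0 := fun h => hy (by
    simp [show y = x + 1 by linear_combination -h])
  have hIH := congrArg (R.opC y) (LinearMap.mem_ker.1 (ih hw))
  have e1 := congrArg (R.opC x) (R.opD_opC (x - 1) y w)
  have e2 := congrArg (R.opC x) (R.opA_opC (x - 1) y w)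
  have e3 := R.opC_opC x y (R.opD (x - 1) w)
  have e4 := R.opC_opC x y (R.opA (x - 1) w)
  rw [LinearMap.mem_ker, hΦ]
  simp only [hΦ, map_sub, map_smul, map_add, map_zero, opC_opC_sub_one] at hIH e1 e2
  have key : ((x - y - 1) * (x - y + 1)) • (l₁.eval (x - 1) • R.opC x (R.opD (x - 1) (R.opC y w)) -
      l₂.eval (x - 1) • R.opC x (R.opA (x - 1) (R.opC y w))) = 0 := by
    linear_combination (norm := module) ((x - y + 1) * l₁.eval (x - 1)) • e1 -
      ((x - y + 1) * l₂.eval (x - 1)) • e2 + ((x - y - 2) * l₁.eval (x - 1)) • e3 -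
      ((x - y - 2) * l₂.eval (x - 1)) • e4 - ((x - y - 2) * (x - y - 1)) • hIH
  exact (smul_eq_zero.1 key).resolve_left (mul_ne_zero h1 h2)

/-- The operator `A(x) D(x - 1) - C(x) B(x - 1)`; up to inverse factors `A` it is the Berezinian. -/
def opP (R : OddPair p V) (x : ℂ) : Module.End ℂ V :=
  R.opA x ∘ₗ R.opD (x - 1) - R.opC x ∘ₗ R.B (x - 1)

theorem opP_apply (x : ℂ) (v : V) :
    R.opP x v = R.opA x (R.opD (x - 1) v) - R.opC x (R.B (x - 1) v) := rfl

theorem opP_opC {x y : ℂ} (h1 : x - y - 1 ≠ 0) (h2 : x - y + 1 ≠ 0) (w : V) :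
    (x - y) • R.opP x (R.opC y w) =
      (x - y - 2) • R.opC y (R.opP x w) + (2 : ℂ) • R.opC x (R.opD (x - 1) (R.opA y w)) := by
  have e1 := congrArg (R.opA x) (R.opD_opC (x - 1) y w)
  have e2 := R.opA_opC x y (R.opD (x - 1) w)
  have e3 := R.opA_opC x (x - 1) (R.opD y w)
  have e4 := congrArg (R.opC x) (R.opB_opC (x - 1) y w)
  have e5 := R.opC_opC x y (R.B (x - 1) w)
  have e6 := congrArg (R.opC x) (R.opA_opD (x - 1) y w)
  have e7 := congrArg (R.opC x) (R.opA_opD y (x - 1) w)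
  simp only [map_sub, map_smul, map_add, opC_opC_sub_one] at e1 e4 e6 e7
  rw [← sub_eq_zero]
  refine (smul_eq_zero.1 ?_).resolve_left (mul_ne_zero (mul_ne_zero h1 h1) h2)
  simp only [opP_apply, map_sub]
  linear_combination (norm := module)
    ((x - y - 1) * (x - y) * (x - y + 1)) • e1 +
    ((x - y - 1) * (x - y + 1) * (x - y - 2)) • e2 +
    ((x - y - 1) * (x - y) * (x - y + 1)) • e3 -
    ((x - y - 1) * (x - y) * (x - y + 1)) • e4 +
    ((x - y + 1) * (x - y - 1) * (x - y - 2)) • e5 +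
    ((x - y) * (x - y + 1)) • e6 - ((x - y + 1) * (x - y - 2)) • e7

theorem opA_opA_opC {x y : ℂ} (h1 : x - y - 1 ≠ 0) (w : V) :
    (x - y) • R.opA x (R.opA (x - 1) (R.opC y w)) =
      (x - y - 2) • R.opC y (R.opA x (R.opA (x - 1) w)) +
        (2 : ℂ) • R.opC x (R.opA (x - 1) (R.opA y w)) := by
  have e1 := congrArg (R.opA x) (R.opA_opC (x - 1) y w)
  have e2 := R.opA_opC x y (R.opA (x - 1) w)
  have e3 := R.opA_opC x (x - 1) (R.opA y w)
  have e4 := congrArg (R.opC x) (R.opA_comm y (x - 1) w)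
  simp only [map_smul, map_add] at e1
  rw [← sub_eq_zero]
  refine (smul_eq_zero.1 ?_).resolve_left h1
  linear_combination (norm := module)
    (x - y) • e1 + (x - y - 2) • e2 + (x - y) • e3 + (x - y - 2) • e4

/-- The Berezinian acts on a highest weight module as a scalar. -/
theorem opP_words {l₁ l₂ : ℂ[X]} (hA : ∀ x, R.opA x ζ = l₁.eval x • ζ)
    (hD : ∀ x, R.opD x ζ = l₂.eval x • ζ) (hB : ∀ x, R.B x ζ = 0) (x : ℂ) {j : ℕ} {w : V}
    (hw : w ∈ R.words ζ j) :
    l₁.eval (x - 1) • R.opP x w = l₂.eval (x - 1) • R.opA x (R.opA (x - 1) w) := by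
  let Φ : Module.End ℂ V := l₁.eval (x - 1) • R.opP x -
    l₂.eval (x - 1) • R.opA x ∘ₗ R.opA (x - 1)
  have hΦ : ∀ v, Φ v = l₁.eval (x - 1) • R.opP x v -
    l₂.eval (x - 1) • R.opA x (R.opA (x - 1) v) := fun v => rfl
  suffices R.words ζ j ≤ LinearMap.ker Φ from
    sub_eq_zero.1 ((hΦ w).symm.trans (LinearMap.mem_ker.1 (this hw)))
  refine words_induction (fun _ => LinearMap.ker Φ) ?_ (fun j ih w hw => ?_) j
  · rw [LinearMap.mem_ker, hΦ, opP_apply, hB, hD, hA, map_zero, map_smul, map_smul, hA]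
    module
  refine ⟨{x, x - 1, x + 1}, fun y hy => ?_⟩
  have h0 : x - y ≠ 0 := fun h => hy (by
    simp [show y = x by linear_combination -h])
  have h1 : x - y - 1 ≠ 0 := fun h => hy (by
    simp [show y = x - 1 by linear_combination -h])
  have h2 : x - y + 1 ≠ 0 := fun h => hy (by
    simp [show y = x + 1 by linear_combination -h])
  have hIH := congrArg (R.opC y) (LinearMap.mem_ker.1 (ih hw))
  have e1 := opC_opD_words hA hD x (opA_mem_words hA y hw)
  have e2 := opP_opC (R := R) h1 h2 w
  have e3 := opA_opA_opC (R := R) h1 w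
  rw [LinearMap.mem_ker]
  refine (smul_eq_zero.1 ?_).resolve_left h0
  simp only [hΦ, map_sub, map_smul, map_zero] at hIH ⊢
  linear_combination (norm := module) (2 : ℂ) • e1 + l₁.eval (x - 1) • e2 -
    l₂.eval (x - 1) • e3 + (x - y - 2) • hIH

/-- The vectors `v` such that the polynomial `c_0 v u^p + ⋯ + c_p v` is divisible by `g(u)`. -/
def dvdSubmodule (p : ℕ) (g : ℂ[X]) (c : ℕ → Module.End ℂ V) : Submodule ℂ V where
  carrier := {v | ∀ f : V →ₗ[ℂ] ℂ, g ∣ dualPoly p (fun r => c r v) f}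
  add_mem' := by
    intro v w hv hw f
    have h : dualPoly p (fun r => c r (v + w)) f =
        dualPoly p (fun r => c r v) f + dualPoly p (fun r => c r w) f := by
      simp [dualPoly, add_mul, Finset.sum_add_distrib]
    rw [h]
    exact dvd_add (hv f) (hw f)
  zero_mem' := by
    intro f
    simp [dualPoly]
  smul_mem' := by
    intro e v hv f
    have h : dualPoly p (fun r => c r (e • v)) f = C e * dualPoly p (fun r => c r v) f := by
      simp [dualPoly, Finset.mul_sum, mul_assoc]
    rw [h]
    exact (hv f).mul_left _

theorem eval_dualPoly_apply (c : ℕ → Module.End ℂ V) (f : V →ₗ[ℂ] ℂ) (v : V) (x : ℂ) :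
    (dualPoly p (fun r => c r v) f).eval x = f (vecEval p c x v) := by
  rw [eval_dualPoly, vecEval_apply]

/-- A factor of the polynomials `A(u) ζ`, `C(u) ζ` and `D(u) ζ` is a factor of `A(u) w`, `C(u) w`
and `D(u) w` for all words `w`. -/
theorem words_le_dvdSubmodule {g : ℂ[X]} (hg : g ≠ 0)
    (h0 : ζ ∈ dvdSubmodule p g R.a ⊓ dvdSubmodule p g R.c ⊓ dvdSubmodule p g R.d) (j : ℕ) :
    R.words ζ j ≤ dvdSubmodule p g R.a ⊓ dvdSubmodule p g R.c ⊓ dvdSubmodule p g R.d := by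
  refine words_induction
    (fun _ => dvdSubmodule p g R.a ⊓ dvdSubmodule p g R.c ⊓ dvdSubmodule p g R.d) h0
    (fun j ih w hw => ?_) j
  obtain ⟨⟨hA, hC⟩, hD⟩ := ih hw
  have hg' : g.comp (X - C 1) ≠ 0 := by
    rw [Ne, comp_eq_zero_iff]
    rintro (h | ⟨-, h⟩)
    · exact hg h
    · simpa using congrArg (coeff · 1) h
  refine ⟨g.roots.toFinset ∪ (g.comp (X - C 1)).roots.toFinset, fun y hy => ?_⟩
  have hy1 : g.eval y ≠ 0 := fun h => hy (by simp [hg, h])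
  have hy2 : g.eval (y - 1) ≠ 0 := fun h => hy (by
    rw [Finset.mem_union]
    right
    rw [Multiset.mem_toFinset, mem_roots hg']
    simp [h])
  -- the relations for `A` and `D` have the same form
  have hAD : ∀ e : ℕ → Module.End ℂ V, w ∈ dvdSubmodule p g e →
      (∀ x y v, (x - y) • vecEval p e x (R.opC y v) =
        (x - y - 1) • R.opC y (vecEval p e x v) + R.opC x (vecEval p e y v)) →
      R.opC y w ∈ dvdSubmodule p g e := by
    intro e he hrel f
    have h1 : g ∣ dualPoly p (fun r => R.c r (vecEval p e y w)) f := by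
      have h2 : (C (y - 1) - X) * dualPoly p (fun r => R.c r (vecEval p e y w)) f =
          (C y - X) * dualPoly p (fun r => R.c r w) (f ∘ₗ vecEval p e y) -
            dualPoly p (fun r => e r w) (f ∘ₗ R.opC y) := by
        refine funext fun x => ?_
        have h3 := congrArg f (hrel y x w)
        simp only [eval_mul, eval_sub, eval_C, eval_X, eval_dualPoly_apply, LinearMap.comp_apply]
        simp only [map_add, map_smul, smul_eq_mul, opC] at h3 ⊢
        linear_combination -h3
      have h4 : IsCoprime g (C (y - 1) - X) := by
        rw [← neg_sub X, IsCoprime.neg_right_iff]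
        exact isCoprime_X_sub_C_of_eval_ne_zero hy2
      refine h4.dvd_of_dvd_mul_left ?_
      rw [h2]
      exact dvd_sub ((hC _).mul_left _) (he _)
    have h2 : (X - C y) * dualPoly p (fun r => e r (R.opC y w)) f =
        (X - C (y + 1)) * dualPoly p (fun r => e r w) (f ∘ₗ R.opC y) +
          dualPoly p (fun r => R.c r (vecEval p e y w)) f := by
      refine funext fun x => ?_
      have h3 := congrArg f (hrel x y w)
      simp only [eval_add, eval_mul, eval_sub, eval_C, eval_X, eval_dualPoly_apply,
        LinearMap.comp_apply]
      simp only [map_add, map_smul, smul_eq_mul, opC] at h3 ⊢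
      linear_combination h3
    refine (isCoprime_X_sub_C_of_eval_ne_zero hy1).dvd_of_dvd_mul_left ?_
    rw [h2]
    exact dvd_add ((he _).mul_left _) h1
  refine ⟨⟨hAD _ hA R.opA_opC, fun f => ?_⟩, hAD _ hD R.opD_opC⟩
  have h2 : (X - C (y - 1)) * dualPoly p (fun r => R.c r (R.opC y w)) f =
      (C (y + 1) - X) * dualPoly p (fun r => R.c r w) (f ∘ₗ R.opC y) := by
    refine funext fun x => ?_
    have h3 := congrArg f (R.opC_opC x y w)
    simp only [eval_mul, eval_sub, eval_C, eval_X, eval_dualPoly_apply, LinearMap.comp_apply]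
    simp only [map_smul, smul_eq_mul, opC] at h3 ⊢
    linear_combination h3
  refine (isCoprime_X_sub_C_of_eval_ne_zero hy2).dvd_of_dvd_mul_left ?_
  rw [h2]
  exact (hC _).mul_left _

/-- Some nonzero word is annihilated by `C(u)`. Indeed `C(z + 1)` annihilates a word containing a
letter `C(z)` that may be moved to the front, and `C(u)` has degree less than `p`. -/
theorem exists_word_opC_eq_zero (hζ : ζ ≠ 0) :
    ∃ j, ∃ w ∈ R.words ζ j, w ≠ 0 ∧ ∀ u, R.opC u w = 0 := by
  by_contra! hcon
  have step : ∀ k, ∃ w ∈ R.words ζ k, w ≠ 0 ∧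
      ∃ S : Finset ℂ, S.card = k ∧ ∀ z ∈ S, R.opC (z + 1) w = 0 := by
    intro k
    induction k with
    | zero => exact ⟨ζ, Submodule.mem_span_singleton_self ζ, hζ, ∅, rfl, by simp⟩
    | succ k ih =>
      obtain ⟨w, hw, hw0, S, hS, hSw⟩ := ih
      obtain ⟨u, hu⟩ := hcon k w hw hw0
      have hy : ∃ y, y ∉ S ∪ S.image (· + 2) ∧ R.opC y w ≠ 0 := by
        by_contra! hcon'
        refine hu ?_
        have h := vecEval_mem_of_infinite (p := p) (c := fun r => R.c r w) (U := ⊥)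
          ((infinite_compl_finset (S ∪ S.image (· + 2))).mono fun y hy => by
            simpa only [opC, vecEval_apply, Set.mem_ofPred_eq, Submodule.mem_bot] using
              hcon' y hy) u
        simpa only [opC, vecEval_apply, Submodule.mem_bot] using h
      obtain ⟨y, hyS, hy0⟩ := hy
      rw [Finset.mem_union, not_or] at hyS
      refine ⟨R.opC y w, opC_mem_words hw y, hy0, insert y S, ?_, fun z hz => ?_⟩
      · rw [Finset.card_insert_of_notMem hyS.1, hS]
      rcases Finset.mem_insert.1 hz with rfl | hz
      · simpa using R.opC_opC_sub_one (z + 1) w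
      · have h := R.opC_opC (z + 1) y w
        rw [hSw z hz, map_zero, smul_zero] at h
        refine (smul_eq_zero.1 h).resolve_left fun h' => hyS.2 ?_
        exact Finset.mem_image.2 ⟨z, hz, by linear_combination h'⟩
  obtain ⟨w, hw, hw0, S, hS, hSw⟩ := step p
  obtain ⟨u, hu⟩ := hcon p w hw hw0
  refine hu ?_
  have h := vecEval_eq_zero_of_card (p := p) (c := fun r => R.c r w) (by simp [R.c_zero])
    (S.image (· + 1)) (by rw [Finset.card_image_of_injective _ (add_left_injective 1), hS])
    (fun x hx => by
      obtain ⟨z, hz, rfl⟩ := Finset.mem_image.1 hx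
      simpa only [opC, vecEval_apply] using hSw z hz) u
  simpa only [opC, vecEval_apply] using h

theorem opC_opA_eq_zero {w : V} (hw : ∀ u, R.opC u w = 0) (x u : ℂ) :
    R.opC u (R.opA x w) = 0 := by
  have h : vecEval p (fun r => R.c r (R.opA x w)) u ∈ (⊥ : Submodule ℂ V) := by
    refine vecEval_mem_of_infinite ((infinite_compl_finset {x}).mono fun y hy => ?_) u
    have hxy : x - y ≠ 0 := sub_ne_zero.2 fun h => hy (by simp [h])
    have h1 := R.opA_opC x y w
    have h2 := R.opA_opC y x w
    rw [hw, map_zero, smul_zero] at h1 h2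
    have h3 : ((x - y) * (x - y)) • R.opC y (R.opA x w) = 0 := by
      linear_combination (norm := module) -(x - y + 1) • h1 - h2
    simpa only [opC, vecEval_apply, Set.mem_ofPred_eq, Submodule.mem_bot] using
      (smul_eq_zero.1 h3).resolve_left (mul_ne_zero hxy hxy)
  simpa only [opC, vecEval_apply, Submodule.mem_bot] using h

theorem monic_comp_X_sub_one {q : ℂ[X]} (h : q.Monic) :
    (q.comp (X - C 1)).Monic ∧ (q.comp (X - C 1)).natDegree = q.natDegree :=
  ⟨h.comp (monic_X_sub_C 1) (by rw [natDegree_X_sub_C]; exact one_ne_zero),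
    by rw [natDegree_comp, natDegree_X_sub_C, mul_one]⟩

/-- The odd reflection in rank two: if the highest weight is `(g m₁, g m₂)` with coprime `m₁` and
`m₂`, and `C(u) ζ` is divisible by `g`, then some nonzero word is a highest vector for the opposite
order of the indices, and its weight is `(g(u) m₁(u - 1), g(u) m₂(u - 1))`. -/
theorem exists_reflected_vector {g m₁ m₂ : ℂ[X]} (hg : g.Monic) (hm₁ : m₁.Monic) (hm₂ : m₂.Monic)
    (hcop : IsCoprime m₁ m₂) (hd₁ : g.natDegree + m₁.natDegree = p)
    (hd₂ : g.natDegree + m₂.natDegree = p) (hζ : ζ ≠ 0)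
    (hA : ∀ x, R.opA x ζ = (g * m₁).eval x • ζ) (hD : ∀ x, R.opD x ζ = (g * m₂).eval x • ζ)
    (hB : ∀ x, R.B x ζ = 0) (hC : ζ ∈ dvdSubmodule p g R.c) :
    ∃ j, ∃ η ∈ R.words ζ j, η ≠ 0 ∧ (∀ x, R.opC x η = 0) ∧
      (∀ x, R.opA x η = (g * m₁.comp (X - C 1)).eval x • η) ∧
      ∀ x, R.opD x η = (g * m₂.comp (X - C 1)).eval x • η := by
  obtain ⟨j, w, hw, hw0, hwC⟩ := exists_word_opC_eq_zero (R := R) hζ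
  -- a common eigenvector of all `A(x)` among the words annihilated by `C(u)`
  obtain ⟨η, ⟨hη, hηC⟩, hη0, hηA⟩ : ∃ η ∈ R.words ζ j ⊓ ⨅ u, LinearMap.ker (R.opC u), η ≠ 0 ∧
      ∀ x, ∃ μ : ℂ, R.opA x η = μ • η := by
    have := finiteDimensional_words (R := R) (ζ := ζ) j
    have : FiniteDimensional ℂ (R.words ζ j ⊓ ⨅ u, LinearMap.ker (R.opC u) : Submodule ℂ V) :=
      Submodule.finiteDimensional_of_le inf_le_left
    refine exists_common_eigenvector R.opA R.opA_comm _ ?_ fun x v hv => ?_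
    · refine (Submodule.ne_bot_iff _).2 ⟨w, ⟨hw, ?_⟩, hw0⟩
      simpa using hwC
    · refine ⟨opA_mem_words hA x hv.1, ?_⟩
      have hv2 : ∀ u, R.opC u v = 0 := by simpa using hv.2
      simpa using opC_opA_eq_zero hv2 x
  replace hηC : ∀ x, R.opC x η = 0 := by simpa using hηC
  obtain ⟨f, hf⟩ : ∃ f : V →ₗ[ℂ] ℂ, f η = 1 :=
    Module.Projective.exists_dual_eq_one ℂ hη0
  set α := dualPoly p (fun r => R.a r η) f with hα
  set δ := dualPoly p (fun r => R.d r η) f with hδ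
  have hαη : ∀ x, R.opA x η = α.eval x • η := by
    intro x
    obtain ⟨μ, hμ⟩ := hηA x
    rw [hα, eval_dualPoly_apply]
    change _ = f (R.opA x η) • η
    rw [hμ, map_smul, hf, smul_eq_mul, mul_one]
  obtain ⟨hαm, hαd⟩ := monic_dualPoly p (fun r => R.a r η) f (by simp [R.a_zero, hf])
  obtain ⟨hδm, hδd⟩ := monic_dualPoly p (fun r => R.d r η) f (by simp [R.d_zero, hf])
  rw [← hα] at hαm hαd
  rw [← hδ] at hδm hδd
  -- on `η` the Berezinian is computed from the eigenvalues of `A` and `D`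
  have hP : ∀ x, R.opP x η = α.eval (x - 1) • R.opD x η := by
    intro x
    have h1 := R.opB_opC x (x - 1) η
    have h2 := R.opA_opD x (x - 1) η
    rw [hηC, map_zero, hαη, hαη, map_smul, map_smul] at h1
    rw [hαη, map_smul] at h2
    rw [opP_apply]
    linear_combination (norm := module) h2 - h1
  have hDη : ∀ x, α.eval (x - 1) ≠ 0 → (g * m₁).eval (x - 1) • R.opD x η =
      ((g * m₂).eval (x - 1) * α.eval x) • η := by
    intro x hx
    have h1 := opP_words hA hD hB x hη
    rw [hP, hαη, map_smul, hαη] at h1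
    refine sub_eq_zero.1 ((smul_eq_zero.1 ?_).resolve_left hx)
    linear_combination (norm := module) h1
  have hl₁ : (g * m₁).Monic := hg.mul hm₁
  have hgood : {x | (α * (g * m₁)).eval (x - 1) ≠ 0}.Infinite := by
    have h := infinite_eval_ne_zero (monic_comp_X_sub_one (hαm.mul hl₁)).1.ne_zero
    refine h.mono fun x hx => ?_
    simpa using hx
  have hδη : ∀ x, R.opD x η = δ.eval x • η := by
    intro x
    have h : vecEval p (fun r => R.d r η) x ∈ Submodule.span ℂ {η} := by
      refine vecEval_mem_of_infinite (hgood.mono fun y hy => ?_) x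
      rw [Set.mem_ofPred_eq, eval_mul] at hy
      rw [Set.mem_ofPred_eq, ← vecEval_apply,
        ← Submodule.smul_mem_iff _ (right_ne_zero_of_mul hy)]
      change _ • R.opD y η ∈ _
      rw [hDη y (left_ne_zero_of_mul hy)]
      exact Submodule.smul_mem _ _ (Submodule.mem_span_singleton_self η)
    obtain ⟨e, he⟩ := Submodule.mem_span_singleton.1 h
    rw [← vecEval_apply] at he
    rw [hδ, eval_dualPoly_apply]
    change R.opD x η = f (vecEval p R.d x η) • η
    rw [← he, map_smul, hf, smul_eq_mul, mul_one, he]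
    rfl
  have hpoly : (g * m₁).comp (X - C 1) * δ = (g * m₂).comp (X - C 1) * α := by
    refine eq_of_infinite_eval_eq _ _ (hgood.mono fun x hx => ?_)
    rw [Set.mem_ofPred_eq, eval_mul] at hx
    have h := congrArg f (hDη x (left_ne_zero_of_mul hx))
    rw [hδη, map_smul, map_smul, map_smul, hf] at h
    simpa using h
  obtain ⟨hg', -⟩ := monic_comp_X_sub_one hg
  obtain ⟨hm₁', hd₁'⟩ := monic_comp_X_sub_one hm₁
  obtain ⟨hm₂', hd₂'⟩ := monic_comp_X_sub_one hm₂
  have hcop' : IsCoprime (m₁.comp (X - C 1)) (m₂.comp (X - C 1)) :=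
    hcop.map (compRingHom (X - C 1))
  have hpoly' : m₁.comp (X - C 1) * δ = m₂.comp (X - C 1) * α := by
    refine mul_left_cancel₀ hg'.ne_zero ?_
    simpa only [mul_comp, mul_assoc] using hpoly
  obtain ⟨e, he⟩ : m₁.comp (X - C 1) ∣ α := hcop'.dvd_of_dvd_mul_left ⟨δ, hpoly'.symm⟩
  have he' : δ = m₂.comp (X - C 1) * e := by
    refine mul_left_cancel₀ hm₁'.ne_zero ?_
    rw [hpoly', he]
    ring
  -- the common factor `g` survives, since it divides `A(u) η` and `D(u) η`
  have hdvd : η ∈ dvdSubmodule p g R.a ⊓ dvdSubmodule p g R.c ⊓ dvdSubmodule p g R.d := by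
    have h : ∀ (c : ℕ → Module.End ℂ V) (q : ℂ[X]),
        (∀ x, vecEval p c x ζ = (g * q).eval x • ζ) → ζ ∈ dvdSubmodule p g c := by
      intro c q hq f'
      refine ⟨q * C (f' ζ), funext fun x => ?_⟩
      rw [eval_dualPoly_apply, hq, map_smul]
      simp [mul_assoc]
    exact words_le_dvdSubmodule hg.ne_zero ⟨⟨h _ _ hA, hC⟩, h _ _ hD⟩ j hη
  have hge : g ∣ e := by
    obtain ⟨u, v, huv⟩ := hcop'
    have h : e = u * α + v * δ := by
      rw [he, he']
      linear_combination -e * huv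
    rw [h]
    exact dvd_add ((hdvd.1.1 f).mul_left u) ((hdvd.2 f).mul_left v)
  have hα' : α = g * m₁.comp (X - C 1) := by
    refine eq_of_monic_of_dvd_of_natDegree_le (hg.mul hm₁') hαm ?_ ?_
    · rw [he, mul_comm g]
      exact mul_dvd_mul_left _ hge
    · rw [hαd, hg.natDegree_mul hm₁', hd₁', hd₁]
  have hδ' : δ = g * m₂.comp (X - C 1) := by
    refine eq_of_monic_of_dvd_of_natDegree_le (hg.mul hm₂') hδm ?_ ?_
    · rw [he', mul_comm g]
      exact mul_dvd_mul_left _ hge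
    · rw [hδd, hg.natDegree_mul hm₂', hd₂', hd₂]
  exact ⟨j, η, hη, hη0, hηC, fun x => hα' ▸ hαη x, fun x => hδ' ▸ hδη x⟩

/-- A polynomial with vector coefficients is divisible by `g` if it is annihilated by all linear
functionals on the polynomial ring that vanish on the multiples of `g`. -/
theorem mem_dvdSubmodule {g : ℂ[X]} {c : ℕ → Module.End ℂ V}
    (h : ∀ ψ : ℂ[X] →ₗ[ℂ] ℂ, (∀ q, ψ (g * q) = 0) →
      ∑ r ∈ Finset.range (p + 1), ψ (X ^ (p - r)) • c r ζ = 0) :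
    ζ ∈ dvdSubmodule p g c := by
  intro f
  rw [← Ideal.mem_span_singleton]
  change _ ∈ (Ideal.span {g}).restrictScalars ℂ
  rw [← Submodule.Quotient.mk_eq_zero, ← Module.forall_dual_apply_eq_zero_iff ℂ]
  intro φ
  have h1 := congrArg f (h (φ ∘ₗ ((Ideal.span {g}).restrictScalars ℂ).mkQ) fun q => by
    rw [LinearMap.comp_apply, Submodule.mkQ_apply, (Submodule.Quotient.mk_eq_zero _).2, map_zero]
    exact Ideal.mem_span_singleton.2 (dvd_mul_right g q))
  rw [map_zero, map_sum] at h1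
  rw [← Submodule.mkQ_apply, ← LinearMap.comp_apply, ← h1, dualPoly, map_sum]
  refine Finset.sum_congr rfl fun r _ => ?_
  rw [map_smul, ← smul_eq_C_mul, map_smul, smul_eq_mul, smul_eq_mul, mul_comm]

/-- A linear functional that vanishes on the multiples of a common factor of the two components of
the highest weight takes `C(u) ζ` to a vector annihilated by `B`. -/
theorem opB_functional_opC {g m₁ m₂ : ℂ[X]} (hA : ∀ x, R.opA x ζ = (g * m₁).eval x • ζ)
    (hD : ∀ x, R.opD x ζ = (g * m₂).eval x • ζ) (hB : ∀ x, R.B x ζ = 0)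
    {ψ : ℂ[X] →ₗ[ℂ] ℂ} (hψ : ∀ q, ψ (g * q) = 0) {z : ℂ} (hz : g.eval z ≠ 0) :
    R.B z (∑ r ∈ Finset.range (p + 1), ψ (X ^ (p - r)) • R.c r ζ) = 0 := by
  rw [← Module.forall_dual_apply_eq_zero_iff ℂ]
  intro f
  have h1 : (C z - X) * dualPoly p (fun r => R.c r ζ) (f ∘ₗ R.B z) =
      g * (C (f ζ) * (C ((g * m₁).eval z) * m₂ - C ((g * m₂).eval z) * m₁)) := by
    refine funext fun y => ?_
    have h2 := congrArg f (R.opB_opC z y ζ)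
    simp only [hA, hB, hD, map_zero, add_zero, map_sub, map_smul, smul_eq_mul, eval_mul] at h2
    simp only [eval_mul, eval_sub, eval_C, eval_X, eval_dualPoly_apply, LinearMap.comp_apply]
    change _ * f (R.B z (R.opC y ζ)) = _
    linear_combination h2
  have h2 : g ∣ dualPoly p (fun r => R.c r ζ) (f ∘ₗ R.B z) := by
    have h3 : IsCoprime g (C z - X) := by
      rw [← neg_sub X, IsCoprime.neg_right_iff]
      exact isCoprime_X_sub_C_of_eval_ne_zero hz
    refine h3.dvd_of_dvd_mul_left ?_
    rw [h1]
    exact dvd_mul_right _ _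
  obtain ⟨q, hq⟩ := h2
  have h3 := hψ q
  rw [← hq, dualPoly, map_sum] at h3
  rw [map_sum, map_sum, ← h3]
  refine Finset.sum_congr rfl fun r _ => ?_
  rw [map_smul, map_smul, ← smul_eq_C_mul, map_smul, smul_eq_mul, smul_eq_mul, mul_comm,
    LinearMap.comp_apply]

end OddPair

namespace LevelYangian

/-! ### The odd pair of two adjacent indices -/

section Reflection

variable {m n : ℕ} {s : ParitySequence m n} {p : ℕ}
variable {V : Type*} [AddCommGroup V] [Module ℂ V] [Module (LevelYangian s p) V]
  [IsScalarTower ℂ (LevelYangian s p) V]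

theorem relSign_left (j k : Fin (m + n)) : relSign s j k j = paritySign (s.term j) := by
  have h : ∀ x y : ZMod 2, x * y + x * x + y * x = x := by decide
  simp [relSign, h]

theorem relSign_right (j k : Fin (m + n)) : relSign s j k k = paritySign (s.term k) := by
  have h : ∀ x y : ZMod 2, x * y + x * y + y * y = y := by decide
  simp [relSign, h]

theorem paritySign_of_add_eq_one {x y : ZMod 2} (h : x + y = 1) :
    paritySign y = -paritySign x := by
  have key : ∀ x y : ZMod 2, x + y = 1 → (x = 0 ∧ y = 1) ∨ (x = 1 ∧ y = 0) := by decide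
  rcases key x y h with ⟨rfl, rfl⟩ | ⟨rfl, rfl⟩ <;> simp [paritySign]

theorem commSign_odd {i i' : Fin (m + n)} (h : s.term i + s.term i' = 1) :
    commSign s i i' i' i = -1 ∧ commSign s i' i i' i = -1 := by
  have h' : s.term i' + s.term i = 1 := by rw [add_comm, h]
  constructor <;> simp [commSign, h, h', paritySign]

theorem evalT_rel_smul (i j k l : Fin (m + n)) (x y : ℂ) (v : V) :
    (x - y) • (evalT s p i j x • evalT s p k l y • v -
        commSign s i j k l • evalT s p k l y • evalT s p i j x • v) =
      relSign s i j k •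
        (evalT s p k j x • evalT s p i l y • v - evalT s p k j y • evalT s p i l x • v) := by
  have h := congrArg (· • v) (evalT_rel s p i j k l x y)
  simpa only [smul_assoc, sub_smul, mul_smul] using h

variable (V) in
/-- The coefficients of `θ^p T_{jl}(θ u)`, as operators on `V`. -/
def twistedCoeff (s : ParitySequence m n) (p : ℕ) [Module (LevelYangian s p) V]
    [IsScalarTower ℂ (LevelYangian s p) V] (θ : ℂ) (j l : Fin (m + n)) (r : ℕ) :
    Module.End ℂ V :=
  θ ^ r • Algebra.lsmul ℂ ℂ V (t s p j l r)

theorem vecEval_twistedCoeff {θ : ℂ} (hθ : θ * θ = 1) (j l : Fin (m + n)) (x : ℂ) (v : V) :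
    vecEval p (twistedCoeff V s p θ j l) x v = θ ^ p • evalT s p j l (θ * x) • v := by
  rw [evalT_smul, vecEval_apply, vecEval, vecEval, Finset.smul_sum]
  refine Finset.sum_congr rfl fun r hr => ?_
  obtain ⟨e, rfl⟩ : ∃ e, p = r + e := Nat.exists_eq_add_of_le
    (Nat.lt_succ_iff.1 (Finset.mem_range.1 hr))
  have h : θ ^ (r + e) * (θ * x) ^ (r + e - r) = x ^ (r + e - r) * θ ^ r := by
    rw [Nat.add_sub_cancel_left, pow_add, mul_pow]
    have : θ ^ e * θ ^ e = 1 := by rw [← mul_pow, hθ, one_pow]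
    linear_combination θ ^ r * x ^ e * this
  rw [smul_smul, h, mul_smul]
  rfl

theorem twistedCoeff_rel {θ : ℂ} (hθ : θ * θ = 1) (i j k l : Fin (m + n)) (x y : ℂ) (v : V) :
    (x - y) • (vecEval p (twistedCoeff V s p θ i j) x (vecEval p (twistedCoeff V s p θ k l) y v) -
      commSign s i j k l •
        vecEval p (twistedCoeff V s p θ k l) y (vecEval p (twistedCoeff V s p θ i j) x v)) =
    (θ * relSign s i j k) •
      (vecEval p (twistedCoeff V s p θ k j) x (vecEval p (twistedCoeff V s p θ i l) y v) -
        vecEval p (twistedCoeff V s p θ k j) y (vecEval p (twistedCoeff V s p θ i l) x v)) := by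
  simp only [vecEval_twistedCoeff hθ]
  simp only [smul_comm (evalT s p _ _ _) (θ ^ p)]
  have h := evalT_rel_smul (s := s) (p := p) i j k l (θ * x) (θ * y) v
  generalize evalT s p i j (θ * x) • evalT s p k l (θ * y) • v = w₁ at h ⊢
  generalize evalT s p k l (θ * y) • evalT s p i j (θ * x) • v = w₂ at h ⊢
  generalize evalT s p k j (θ * x) • evalT s p i l (θ * y) • v = w₃ at h ⊢
  generalize evalT s p k j (θ * y) • evalT s p i l (θ * x) • v = w₄ at h ⊢
  have h' : (x - y) • (w₁ - commSign s i j k l • w₂) = (θ * relSign s i j k) • (w₃ - w₄) := by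
    rw [mul_smul, ← h, smul_smul]
    congr 1
    linear_combination (y - x) * hθ
  linear_combination (norm := module) (θ ^ p * θ ^ p) • h'

/-- The odd pair formed by `T_{ii}`, `T_{ii'}`, `T_{i'i}` and `T_{i'i'}` for indices `i` and `i'` of
different parities. The substitution `u ↦ θ u` with `θ = (-1)^{s_i}` takes care of the two possible
orders of the parities. -/
def oddPair (s : ParitySequence m n) (p : ℕ) (V : Type*) [AddCommGroup V] [Module ℂ V]
    [Module (LevelYangian s p) V] [IsScalarTower ℂ (LevelYangian s p) V] {i i' : Fin (m + n)}
    (h : s.term i + s.term i' = 1) : OddPair p V :=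
  have hθ : paritySign (s.term i) * paritySign (s.term i) = 1 := paritySign_mul_self _
  have hθ' : paritySign (s.term i) * paritySign (s.term i') = -1 := by
    rw [paritySign_of_add_eq_one h, mul_neg, hθ]
  have hne : i ≠ i' := by
    rintro rfl
    rw [CharTwo.add_self_eq_zero] at h
    exact zero_ne_one h
  { a := twistedCoeff V s p (paritySign (s.term i)) i i
    B := vecEval p (twistedCoeff V s p (paritySign (s.term i)) i i')
    c := twistedCoeff V s p (paritySign (s.term i)) i' i
    d := twistedCoeff V s p (paritySign (s.term i)) i' i'
    a_zero := by simp [twistedCoeff, t_zero]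
    c_zero := by simp [twistedCoeff, t_zero, hne.symm]
    d_zero := by simp [twistedCoeff, t_zero]
    rel_AA := fun x y v => by
      have h1 := twistedCoeff_rel (V := V) (s := s) (p := p) hθ i i i i x y v
      have h2 := twistedCoeff_rel (V := V) (s := s) (p := p) hθ i i i i y x v
      rw [relSign_self, hθ, commSign_self] at h1 h2
      rw [← sub_eq_zero]
      refine (smul_eq_zero.1 ?_).resolve_left (two_ne_zero (α := ℂ))
      linear_combination (norm := module) h2 - h1
    rel_AC := fun x y v => by
      have h1 := twistedCoeff_rel (V := V) (s := s) (p := p) hθ i i i' i x y v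
      rw [relSign_self, hθ, commSign_self] at h1
      linear_combination (norm := module) h1
    rel_DC := fun x y v => by
      have h1 := twistedCoeff_rel (V := V) (s := s) (p := p) hθ i' i i' i' y x v
      rw [relSign_left, hθ', commSign_symm, commSign_self] at h1
      linear_combination (norm := module) h1
    rel_BC := fun x y v => by
      have h1 := twistedCoeff_rel (V := V) (s := s) (p := p) hθ i i' i' i x y v
      rw [relSign_right, hθ', (commSign_odd h).1] at h1
      linear_combination (norm := module) h1
    rel_CC := fun x y v => by
      have h1 := twistedCoeff_rel (V := V) (s := s) (p := p) hθ i' i i' i x y v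
      rw [relSign_left, hθ', (commSign_odd h).2] at h1
      linear_combination (norm := module) h1
    rel_AD := fun x y v => by
      have h1 := twistedCoeff_rel (V := V) (s := s) (p := p) hθ i i i' i' x y v
      rw [relSign_self, hθ, commSign_self] at h1
      linear_combination (norm := module) h1 }

/-- If one of the factors on the right-hand side of the defining relation annihilates `v`, then the
two operators super-commute on `v`. -/
theorem evalT_comm_smul {i j k l : Fin (m + n)} {x y : ℂ} (hxy : x ≠ y) {v : V}
    (h : (∀ z, evalT s p k j z • v = 0) ∨ ∀ z, evalT s p i l z • v = 0) :
    evalT s p i j x • evalT s p k l y • v =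
      commSign s i j k l • evalT s p k l y • evalT s p i j x • v := by
  rcases h with h | h
  · have h1 := evalT_rel_smul (s := s) (p := p) k l i j y x v
    simp only [h, smul_zero, sub_zero] at h1
    rw [smul_eq_zero, or_iff_right (sub_ne_zero.2 hxy.symm), sub_eq_zero] at h1
    rw [h1, commSign_symm s k l, smul_smul (commSign s i j k l) (commSign s i j k l),
      commSign_mul_self, one_smul]
  · have h1 := evalT_rel_smul (s := s) (p := p) i j k l x y v
    simp only [h, smul_zero, sub_zero] at h1
    rwa [smul_eq_zero, or_iff_right (sub_ne_zero.2 hxy), sub_eq_zero] at h1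

theorem evalT_smul_eq_of_forall_ne {j l : Fin (m + n)} {q : ℂ[X]} {v : V} {y : ℂ}
    (h : ∀ x, x ≠ y → evalT s p j l x • v = q.eval x • v) (x : ℂ) :
    evalT s p j l x • v = q.eval x • v := by
  rw [← sub_eq_zero, ← Module.forall_dual_apply_eq_zero_iff ℂ]
  intro f
  have hpoly : dualPoly p (fun r => t s p j l r • v) f = q * C (f v) := by
    refine eq_of_infinite_eval_eq _ _ ((infinite_compl_finset {y}).mono fun x hx => ?_)
    rw [Set.mem_ofPred_eq, eval_dualPoly, ← evalT_smul, h x (by simpa using hx), map_smul,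
      eval_mul, eval_C, smul_eq_mul]
  rw [map_sub, evalT_smul, ← eval_dualPoly, hpoly, map_smul, eval_mul, eval_C, smul_eq_mul,
    sub_self]

theorem evalT_smul_eq_zero_of_forall_ne {j l : Fin (m + n)} {v : V} {y : ℂ}
    (h : ∀ x, x ≠ y → evalT s p j l x • v = 0) (x : ℂ) : evalT s p j l x • v = 0 := by
  simpa using evalT_smul_eq_of_forall_ne (s := s) (p := p) (j := j) (l := l) (v := v) (q := 0) (y := y)
    (by simpa using h) x

variable (s p V) in
/-- The vectors that satisfy the conditions on a highest vector of weight `λ(u)` except those that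
involve only the indices `i` and `i'`. -/
def leviSpace (lam : Fin (m + n) → ℂ[X]) (i i' : Fin (m + n)) : Submodule ℂ V where
  carrier := {v | (∀ j l, j < l → ¬(j = i ∧ l = i') → ∀ x, evalT s p j l x • v = 0) ∧
    ∀ j, j ≠ i → j ≠ i' → ∀ x, evalT s p j j x • v = (lam j).eval x • v}
  add_mem' := by
    rintro v w ⟨hv, hv'⟩ ⟨hw, hw'⟩
    refine ⟨fun j l hjl hne x => ?_, fun j hj hj' x => ?_⟩
    · rw [smul_add, hv j l hjl hne, hw j l hjl hne, add_zero]
    · rw [smul_add, hv' j hj hj', hw' j hj hj', smul_add]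
  zero_mem' := by simp
  smul_mem' := by
    rintro c v ⟨hv, hv'⟩
    refine ⟨fun j l hjl hne x => ?_, fun j hj hj' x => ?_⟩
    · rw [smul_comm, hv j l hjl hne, smul_zero]
    · rw [smul_comm, hv' j hj hj', smul_comm]

theorem evalT_smul_mem_leviSpace {lam : Fin (m + n) → ℂ[X]} {i i' : Fin (m + n)}
    (hi : (i' : ℕ) = (i : ℕ) + 1) {v : V} (hv : v ∈ leviSpace s p V lam i i') (y : ℂ) :
    evalT s p i' i y • v ∈ leviSpace s p V lam i i' := by
  obtain ⟨hv, hv'⟩ := hv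
  refine ⟨fun j l hjl hne => evalT_smul_eq_zero_of_forall_ne (y := y) fun x hx => ?_,
    fun j hj hj' => evalT_smul_eq_of_forall_ne (y := y) fun x hx => ?_⟩
  · rw [evalT_comm_smul hx, hv j l hjl hne, smul_zero, smul_zero]
    rcases lt_or_ge i' l with hl | hl
    · refine Or.inl (hv i' l hl ?_)
      rintro ⟨rfl, -⟩
      omega
    · refine Or.inr (hv j i ?_ ?_)
      · by_contra hji
        refine hne ⟨?_, ?_⟩ <;> apply Fin.ext <;>
          simp only [Fin.lt_def, Fin.le_def, not_lt] at hjl hl hji <;> omega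
      · rintro ⟨-, rfl⟩
        omega
  · rw [evalT_comm_smul hx, hv' j hj hj', commSign_self, one_smul, smul_comm]
    rcases lt_or_ge i' j with hl | hl
    · refine Or.inl (hv i' j hl ?_)
      rintro ⟨rfl, -⟩
      omega
    · refine Or.inr (hv j i ?_ ?_)
      · rw [Ne, Fin.ext_iff] at hj hj'
        rw [Fin.le_def] at hl
        rw [Fin.lt_def]
        omega
      · rintro ⟨-, rfl⟩
        omega

/-- In a simple module with a nonzero vector of degree `ν`, there is no nonzero singular vector of
degree `ν - 1`. -/
theorem eq_zero_of_singular [IsSimpleModule (LevelYangian s p) V] {ζ : V} (hζ : ζ ≠ 0) {ν : ℂ}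
    (hν : gradingElement s p • ζ = ν • ζ) {v : V}
    (hv : ∀ j l, j < l → ∀ x, evalT s p j l x • v = 0)
    (hdeg : gradingElement s p • v = (ν - 1) • v) : v = 0 := by
  let E : Submodule ℂ V :=
    { carrier := {w | (∀ j l, j < l → ∀ x, evalT s p j l x • w = 0) ∧
        gradingElement s p • w = (ν - 1) • w}
      add_mem' := by
        rintro w w' ⟨h1, h2⟩ ⟨h1', h2'⟩
        exact ⟨fun j l hjl x => by rw [smul_add, h1 j l hjl, h1' j l hjl, add_zero],
          by rw [smul_add, h2, h2', smul_add]⟩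
      zero_mem' := by simp
      smul_mem' := by
        rintro c w ⟨h1, h2⟩
        exact ⟨fun j l hjl x => by rw [smul_comm, h1 j l hjl, smul_zero],
          by rw [smul_comm, h2, smul_comm]⟩ }
  have hE : E = ⊥ := by
    refine eq_bot_of_singular hζ (μ := ν - 1) hν (fun k hk => ?_) (fun w hw => hw.2)
      (fun j l hjl r w hw => t_smul_eq_zero_of_evalT (hw.1 j l hjl) r)
      (fun j r w hw => ⟨fun b c hbc => ?_, ?_⟩)
    · have h1 : ((k + 1 : ℕ) : ℂ) = 0 := by
        push_cast
        linear_combination -hk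
      exact Nat.succ_ne_zero k (Nat.cast_eq_zero.1 h1)
    · have h1 : ∀ x y, evalT s p b c x • evalT s p j j y • w = 0 := fun x y =>
        evalT_smul_eq_zero_of_forall_ne (y := y) (fun x hx => by
          rw [evalT_comm_smul hx, hw.1 b c hbc, smul_zero, smul_zero]
          rcases lt_or_ge j c with h | h
          · exact Or.inl (hw.1 j c h)
          · exact Or.inr (hw.1 b j (hbc.trans_le h))) x
      intro x
      have h2 := t_smul_mem_of_evalT (i := j) (j := j) (v := w)
        (U := LinearMap.ker (Algebra.lsmul ℂ ℂ V (evalT s p b c x))) (fun y => h1 x y) r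
      exact h2
    · rw [gradingElement_smul_t r hw.2]
      congr 1
      ring
  have hmem : v ∈ E := ⟨hv, hdeg⟩
  rwa [hE, Submodule.mem_bot] at hmem

/-- The product of the factors `u + θ c_r` over the `r` that satisfy `P`. -/
def partProduct (θ : ℂ) (c : Fin p → ℂ) (P : Fin p → Prop) [DecidablePred P] : ℂ[X] :=
  ∏ r with P r, (X + C (θ * c r))

theorem monic_partProduct (θ : ℂ) (c : Fin p → ℂ) (P : Fin p → Prop) [DecidablePred P] :
    (partProduct θ c P).Monic := monic_prod_of_monic _ _ fun _ _ => monic_X_add_C _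

theorem natDegree_partProduct (θ : ℂ) (c : Fin p → ℂ) (P : Fin p → Prop) [DecidablePred P] :
    (partProduct θ c P).natDegree = (Finset.univ.filter P).card := by
  rw [partProduct, natDegree_prod_of_monic _ _ fun _ _ => monic_X_add_C _]
  simp only [natDegree_X_add_C, Finset.sum_const, smul_eq_mul, mul_one]

theorem eval_partProduct_mul {θ : ℂ} (hθ : θ * θ = 1) (k : ℕ) (c : Fin p → ℂ) (x : ℂ) :
    (partProduct θ c (fun r => ¬(r : ℕ) < k) * partProduct θ c (fun r => (r : ℕ) < k)).eval x =
      θ ^ p * ∏ r : Fin p, (θ * x + c r) := by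
  rw [mul_comm, partProduct, partProduct, Finset.prod_filter_mul_prod_filter_not, eval_prod]
  conv_rhs => rw [← Fin.prod_const p θ, ← Finset.prod_mul_distrib]
  refine Finset.prod_congr rfl fun r _ => ?_
  rw [eval_add, eval_X, eval_C]
  linear_combination -x * hθ

theorem eval_partProduct_mul_comp {θ : ℂ} (hθ : θ * θ = 1) (k : ℕ) (c : Fin p → ℂ) (x : ℂ) :
    (partProduct θ c (fun r => ¬(r : ℕ) < k) *
      (partProduct θ c (fun r => (r : ℕ) < k)).comp (X - C 1)).eval x =
      θ ^ p * (shiftedProduct (-θ) k c).eval (θ * x) := by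
  rw [mul_comm, eval_mul, eval_comp, partProduct, partProduct, eval_prod, eval_prod,
    shiftedProduct, eval_prod]
  conv_rhs => rw [← Fin.prod_const p θ, ← Finset.prod_mul_distrib]
  rw [← Finset.prod_filter_mul_prod_filter_not Finset.univ (fun r : Fin p => (r : ℕ) < k)
    (fun r => θ * eval (θ * x) _)]
  congr 1 <;> refine Finset.prod_congr rfl fun r hr => ?_
  · rw [if_pos (Finset.mem_filter.1 hr).2]
    simp only [eval_add, eval_sub, eval_X, eval_C]
    linear_combination (1 - x) * hθ
  · rw [if_neg (Finset.mem_filter.1 hr).2]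
    simp only [eval_add, eval_X, eval_C]
    linear_combination -x * hθ

theorem eval_highestWeight {N : ℕ} (a : Fin N → Fin p → ℂ) (j : Fin N) (x : ℂ) :
    (highestWeight a j).eval x = ∏ r : Fin p, (x + a j r) := by
  simp [highestWeight, eval_prod]

/-- The odd reflection of a highest vector in a simple module. -/
theorem IsHighest.exists_reflected [IsSimpleModule (LevelYangian s p) V]
    {a : Fin (m + n) → Fin p → ℂ} {ζ : V} (hζ : ζ ≠ 0) (h : IsHighest s p (highestWeight a) ζ)
    {i i' : Fin (m + n)} (hi : (i' : ℕ) = (i : ℕ) + 1) (hs : s.term i + s.term i' = 1) {k : ℕ}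
    (hcommon : ∀ r : Fin p, k ≤ (r : ℕ) → a i r = a i' r)
    (hdistinct : ∀ r q : Fin p, (r : ℕ) < k → (q : ℕ) < k → a i r ≠ a i' q) :
    ∃ η : V, η ≠ 0 ∧
      (∀ j l, j < l → ∀ x, evalT s p (Equiv.swap i i' j) (Equiv.swap i i' l) x • η = 0) ∧
      ∀ j x, evalT s p (Equiv.swap i i' j) (Equiv.swap i i' j) x • η =
        (reflectedWeight (-paritySign (s.term i)) k i i' a j).eval x • η := by
  have hii' : i < i' := by rw [Fin.lt_def]; omega
  have hθ : paritySign (s.term i) * paritySign (s.term i) = 1 := paritySign_mul_self _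
  set θ := paritySign (s.term i) with hθdef
  have hθp : θ ^ p * θ ^ p = 1 := by rw [← mul_pow, hθ, one_pow]
  have hθθ : ∀ x, θ * (θ * x) = x := fun x => by rw [← mul_assoc, hθ, one_mul]
  let R := oddPair s p V hs
  have hRA : ∀ x v, R.opA x v = θ ^ p • evalT s p i i (θ * x) • v :=
    vecEval_twistedCoeff hθ i i
  have hRB : ∀ x v, R.B x v = θ ^ p • evalT s p i i' (θ * x) • v :=
    vecEval_twistedCoeff hθ i i'
  have hRC : ∀ x v, R.opC x v = θ ^ p • evalT s p i' i (θ * x) • v :=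
    vecEval_twistedCoeff hθ i' i
  have hRD : ∀ x v, R.opD x v = θ ^ p • evalT s p i' i' (θ * x) • v :=
    vecEval_twistedCoeff hθ i' i'
  set g := partProduct θ (a i) (fun r => ¬(r : ℕ) < k) with hg
  have hg' : g = partProduct θ (a i') (fun r => ¬(r : ℕ) < k) := by
    refine Finset.prod_congr rfl fun r hr => ?_
    rw [hcommon r (not_lt.1 (Finset.mem_filter.1 hr).2)]
  set m₁ := partProduct θ (a i) (fun r => (r : ℕ) < k) with hm₁
  set m₂ := partProduct θ (a i') (fun r => (r : ℕ) < k) with hm₂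
  have hcop : IsCoprime m₁ m₂ := by
    refine IsCoprime.prod_left fun r hr => IsCoprime.prod_right fun q hq => ?_
    rw [show X + C (θ * a i' q) = X - C (-(θ * a i' q)) by rw [C_neg, sub_neg_eq_add]]
    refine isCoprime_X_sub_C_of_eval_ne_zero fun h0 => ?_
    refine hdistinct r q (Finset.mem_filter.1 hr).2 (Finset.mem_filter.1 hq).2 ?_
    rw [eval_add, eval_X, eval_C] at h0
    linear_combination θ * h0 + (a i' q - a i r) * hθ
  have hcard : (Finset.univ.filter fun r : Fin p => ¬(r : ℕ) < k).card +
      (Finset.univ.filter fun r : Fin p => (r : ℕ) < k).card = p := by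
    rw [add_comm, Finset.card_filter_add_card_filter_not, Finset.card_univ, Fintype.card_fin]
  have hA : ∀ x, R.opA x ζ = (g * m₁).eval x • ζ := fun x => by
    rw [hRA, h.diag, smul_smul, hg, hm₁, eval_partProduct_mul hθ, eval_highestWeight]
  have hD : ∀ x, R.opD x ζ = (g * m₂).eval x • ζ := fun x => by
    rw [hRD, h.diag, smul_smul, hg', hm₂, eval_partProduct_mul hθ, eval_highestWeight]
  have hB : ∀ x, R.B x ζ = 0 := fun x => by rw [hRB, h.raise i i' hii', smul_zero]
  have hLevi : ζ ∈ leviSpace s p V (highestWeight a) i i' :=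
    ⟨fun j l hjl _ => h.raise j l hjl, fun j _ _ => h.diag j⟩
  have hstable : ∀ v ∈ leviSpace s p V (highestWeight a) i i', ∀ r,
      R.c r v ∈ leviSpace s p V (highestWeight a) i i' := fun v hv r =>
    Submodule.smul_mem _ _ (t_smul_mem_of_evalT (fun y => evalT_smul_mem_leviSpace hi hv y) r)
  have hC : ζ ∈ OddPair.dvdSubmodule p g R.c := by
    refine OddPair.mem_dvdSubmodule fun ψ hψ => ?_
    obtain ⟨ν, hν⟩ := h.exists_degree
    -- the vector is singular, of degree one less than `ζ`
    refine eq_zero_of_singular hζ hν (fun j l hjl => ?_) ?_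
    · by_cases hjl' : j = i ∧ l = i'
      · obtain ⟨rfl, rfl⟩ := hjl'
        intro x
        have hinf := infinite_eval_ne_zero (monic_partProduct θ (a j) fun r => ¬(r : ℕ) < k).ne_zero
        rw [evalT_smul, ← Submodule.mem_bot ℂ]
        refine vecEval_mem_of_infinite ((hinf.image (mul_right_injective₀
          (left_ne_zero_of_mul_eq_one hθ)).injOn).mono ?_) x
        rintro _ ⟨z, hz, rfl⟩
        have h1 := OddPair.opB_functional_opC hA hD hB hψ hz
        rw [hRB, smul_eq_zero, or_iff_right (left_ne_zero_of_mul_eq_one hθp)] at h1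
        rwa [Set.mem_ofPred_eq, Submodule.mem_bot, ← evalT_smul]
      · exact (Submodule.sum_mem (leviSpace s p V (highestWeight a) i i') fun r _ =>
          Submodule.smul_mem _ _ (hstable ζ hLevi r)).1 j l hjl hjl'
    · rw [Finset.smul_sum, Finset.smul_sum]
      refine Finset.sum_congr rfl fun r _ => ?_
      change _ • _ • θ ^ r • t s p i' i r • ζ = _ • _ • θ ^ r • t s p i' i r • ζ
      have h1 : ν + ((i : ℕ) : ℂ) - ((i' : ℕ) : ℂ) = ν - 1 := by
        rw [hi]
        push_cast
        ring
      rw [smul_comm, smul_comm (gradingElement s p), gradingElement_smul_t r hν, h1,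
        smul_comm (θ ^ r), smul_comm (ψ _)]
  obtain ⟨j, η, hη, hη0, hηC, hηA, hηD⟩ := OddPair.exists_reflected_vector
    (monic_partProduct _ _ _) (monic_partProduct _ _ _) (monic_partProduct _ _ _) hcop
    (by rw [natDegree_partProduct, natDegree_partProduct, hcard])
    (by rw [natDegree_partProduct, natDegree_partProduct, hcard]) hζ hA hD hB hC
  have hηL : η ∈ leviSpace s p V (highestWeight a) i i' := by
    refine OddPair.words_induction (fun _ => leviSpace s p V (highestWeight a) i i') hLevi
      (fun j ih w hw => ⟨∅, fun y _ => ?_⟩) j hη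
    rw [OddPair.opC, vecEval_apply]
    exact vecEval_mem (fun r _ => hstable w (ih hw) r) y
  have hcancel : ∀ v w : V, θ ^ p • v = θ ^ p • w → v = w := fun v w hvw => by
    rw [← one_smul ℂ v, ← one_smul ℂ w, ← hθp, mul_smul, hvw, mul_smul]
  refine ⟨η, hη0, fun j l hjl x => ?_, fun j x => ?_⟩
  · by_cases hjl' : j = i ∧ l = i'
    · obtain ⟨rfl, rfl⟩ := hjl'
      rw [Equiv.swap_apply_left, Equiv.swap_apply_right]
      have h1 := hηC (θ * x)
      rw [hRC, hθθ] at h1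
      exact hcancel _ _ (by rw [h1, smul_zero])
    · refine hηL.1 _ _ ?_ ?_ x
      · simp only [Equiv.swap_apply_def]
        rw [Fin.lt_def] at hjl
        rw [Fin.ext_iff, Fin.ext_iff] at hjl'
        simp only [Fin.lt_def, Fin.ext_iff]
        split_ifs <;> omega
      · rintro ⟨h1, h2⟩
        rw [Equiv.swap_apply_eq_iff, Equiv.swap_apply_left] at h1
        rw [Equiv.swap_apply_eq_iff, Equiv.swap_apply_right] at h2
        rw [h1, h2] at hjl
        exact lt_asymm hjl hii'
  · by_cases hji : j = i
    · subst hji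
      rw [Equiv.swap_apply_left, reflectedWeight, if_pos rfl]
      have h1 := hηD (θ * x)
      rw [hRD, hθθ, ← hg, hg', eval_partProduct_mul_comp hθ, hθθ, mul_smul] at h1
      exact hcancel _ _ h1
    by_cases hji' : j = i'
    · subst hji'
      rw [Equiv.swap_apply_right, reflectedWeight, if_neg hji, if_pos rfl]
      have h1 := hηA (θ * x)
      rw [hRA, hθθ, eval_partProduct_mul_comp hθ, hθθ, mul_smul] at h1
      exact hcancel _ _ h1
    rw [Equiv.swap_apply_of_ne_of_ne hji hji', reflectedWeight, if_neg hji, if_neg hji']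
    exact hηL.2 j hji hji' x

end Reflection

/-! ### Twisting by the re-labelling isomorphism -/

section Twist

variable {m n : ℕ} {s s' : ParitySequence m n} {p : ℕ}
variable {A : Type} [Ring A] [Algebra ℂ A] {V : Type} [AddCommGroup V] [Module ℂ V] [Module A V]
  [IsScalarTower ℂ A V]

theorem isomorphicAlong_L [IsSimpleModule A V] (f : LevelYangian s' p ≃ₐ[ℂ] A)
    {lam : Fin (m + n) → ℂ[X]} {v : V} (hv : v ≠ 0)
    (hraise : ∀ j l, j < l → ∀ x, f (evalT s' p j l x) • v = 0)
    (hdiag : ∀ j x, f (evalT s' p j j x) • v = (lam j).eval x • v) :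
    IsomorphicAlong f V (L s' p lam) := by
  let _ : Module (LevelYangian s' p) V := Module.compHom V (f : LevelYangian s' p →+* A)
  have hsmul : ∀ (y : LevelYangian s' p) (w : V), y • w = f y • w := fun _ _ => rfl
  have : IsScalarTower ℂ (LevelYangian s' p) V :=
    ⟨fun c y w => by rw [hsmul, hsmul, map_smul, smul_assoc]⟩
  have : Nontrivial V := ⟨v, 0, hv⟩
  have : IsSimpleModule (LevelYangian s' p) V := by
    refine isSimpleModule_iff_toSpanSingleton_surjective.2 ⟨inferInstance, fun w hw u => ?_⟩
    obtain ⟨y, hy⟩ := IsSimpleModule.toSpanSingleton_surjective A hw u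
    refine ⟨f.symm y, ?_⟩
    rw [LinearMap.toSpanSingleton_apply, hsmul, AlgEquiv.apply_symm_apply]
    exact hy
  have hhigh : IsHighest s' p lam v := ⟨hraise, hdiag⟩
  obtain ⟨φ⟩ := nonempty_equiv_L hv hhigh
  exact ⟨φ.restrictScalars ℂ, fun y w => φ.map_smul y w⟩

theorem nontrivial_verma_of_twist (f : LevelYangian s' p ≃ₐ[ℂ] A) {lam : Fin (m + n) → ℂ[X]}
    {v : V} (hv : v ≠ 0) (hraise : ∀ j l, j < l → ∀ x, f (evalT s' p j l x) • v = 0)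
    (hdiag : ∀ j x, f (evalT s' p j j x) • v = (lam j).eval x • v) :
    Nontrivial (Verma s' p lam) := by
  let _ : Module (LevelYangian s' p) V := Module.compHom V (f : LevelYangian s' p →+* A)
  have hsmul : ∀ (y : LevelYangian s' p) (w : V), y • w = f y • w := fun _ _ => rfl
  have : IsScalarTower ℂ (LevelYangian s' p) V :=
    ⟨fun c y w => by rw [hsmul, hsmul, map_smul, smul_assoc]⟩
  have hhigh : IsHighest s' p lam v := ⟨hraise, hdiag⟩
  exact nontrivial_verma hv hhigh

theorem interchangeEquiv_evalT (s : ParitySequence m n) (p : ℕ) (i i' j l : Fin (m + n)) (x : ℂ) :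
    interchangeEquiv s p i i' (evalT (s.interchange i i') p j l x) =
      evalT s p (Equiv.swap i i' j) (Equiv.swap i i' l) x := by
  unfold evalT vecEval
  rw [map_sum]
  refine Finset.sum_congr rfl fun r _ => ?_
  rw [map_smul]
  congr 1
  exact relabelHom_t _ _ _ _ _ _ _ _

theorem interchangeEquiv_symm_evalT (s : ParitySequence m n) (p : ℕ) (i i' j l : Fin (m + n))
    (x : ℂ) : (interchangeEquiv s p i i').symm (evalT s p j l x) =
      evalT (s.interchange i i') p (Equiv.swap i i' j) (Equiv.swap i i' l) x := by
  rw [AlgEquiv.symm_apply_eq, interchangeEquiv_evalT, Equiv.swap_apply_self,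
    Equiv.swap_apply_self]

theorem isomorphicAlong_of_subsingleton {B : Type} [Ring B] [Algebra ℂ B] (f : B ≃ₐ[ℂ] A)
    (V W : Type) [AddCommGroup V] [AddCommGroup W] [Module ℂ V] [Module ℂ W] [Module A V]
    [Module B W] [Subsingleton V] [Subsingleton W] : IsomorphicAlong f V W :=
  ⟨0, fun _ _ => Subsingleton.elim _ _⟩

end Twist

/-- The parameters of the weight obtained from the weight with parameters `a` by the odd reflection
in the adjacent indices `i` and `i'`, for `ε = ±1`. -/
def reflectedParameters {N p : ℕ} (ε : ℂ) (k : ℕ) (i i' : Fin N) (a : Fin N → Fin p → ℂ)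
    (j : Fin N) (r : Fin p) : ℂ :=
  a (Equiv.swap i i' j) r + if (j = i ∨ j = i') ∧ (r : ℕ) < k then ε else 0

theorem highestWeight_reflectedParameters {N p : ℕ} (ε : ℂ) (k : ℕ) (i i' : Fin N)
    (a : Fin N → Fin p → ℂ) :
    highestWeight (reflectedParameters ε k i i' a) = reflectedWeight ε k i i' a := by
  funext j
  unfold reflectedWeight highestWeight shiftedProduct reflectedParameters
  split_ifs with hji hji'
  · subst hji
    refine Finset.prod_congr rfl fun r _ => ?_
    split_ifs <;> simp_all
  · subst hji'
    refine Finset.prod_congr rfl fun r _ => ?_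
    split_ifs <;> simp_all
  · refine Finset.prod_congr rfl fun r _ => ?_
    simp [hji, hji', Equiv.swap_apply_of_ne_of_ne hji hji']

theorem reflectedWeight_reflectedParameters {N p : ℕ} (ε : ℂ) (k : ℕ) {i i' : Fin N}
    (a : Fin N → Fin p → ℂ) :
    reflectedWeight (-ε) k i i' (reflectedParameters ε k i i' a) = highestWeight a := by
  rw [← highestWeight_reflectedParameters]
  congr 1
  funext j r
  have h : (Equiv.swap i i' j = i ∨ Equiv.swap i i' j = i') ↔ (j = i ∨ j = i') := by
    rw [Equiv.swap_apply_eq_iff, Equiv.swap_apply_eq_iff, Equiv.swap_apply_left,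
      Equiv.swap_apply_right, or_comm]
  unfold reflectedParameters
  rw [Equiv.swap_apply_self]
  simp only [h]
  split_ifs <;> ring

/-- The odd reflection of `L(λ(u))`, for both orders of the parities. No basis of the Verma modules
is needed: if `M(λ(u))` vanishes, then so does the Verma module of the reflected weight, since
otherwise the reflection in the opposite direction would produce a nonzero vector of highest weight
`λ(u)`. -/
theorem isomorphicAlong_reflected {m n p : ℕ} (s : ParitySequence m n)
    (a : Fin (m + n) → Fin p → ℂ) {i i' : Fin (m + n)} (hi : (i' : ℕ) = (i : ℕ) + 1)
    (hs : s.term i + s.term i' = 1) {k : ℕ}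
    (hcommon : ∀ r : Fin p, k ≤ (r : ℕ) → a i r = a i' r)
    (hdistinct : ∀ r q : Fin p, (r : ℕ) < k → (q : ℕ) < k → a i r ≠ a i' q) :
    IsomorphicAlong (interchangeEquiv s p i i') (L s p (highestWeight a))
      (L (s.interchange i i') p (reflectedWeight (-paritySign (s.term i)) k i i' a)) := by
  rcases subsingleton_or_nontrivial (Verma s p (highestWeight a)) with h0 | h0
  · have h1 : Subsingleton (Verma (s.interchange i i') p
        (reflectedWeight (-paritySign (s.term i)) k i i' a)) := by
      by_contra h1
      rw [not_subsingleton_iff_nontrivial] at h1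
      rw [← highestWeight_reflectedParameters] at h1
      have := isSimpleModule_L (s := s.interchange i i') (p := p)
        (highestWeight (reflectedParameters (-paritySign (s.term i)) k i i' a))
      obtain ⟨ζ, hζ, hζ'⟩ := exists_isHighest_L (s := s.interchange i i') (p := p)
        (highestWeight (reflectedParameters (-paritySign (s.term i)) k i i' a))
      have hsi : (s.interchange i i').term i = s.term i' :=
        congrArg s.term (Equiv.swap_apply_left i i')
      have hsi' : (s.interchange i i').term i' = s.term i :=
        congrArg s.term (Equiv.swap_apply_right i i')
      obtain ⟨η, hη, hraise, hdiag⟩ := hζ'.exists_reflected hζ hi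
        (by rw [hsi, hsi', add_comm, hs]) (k := k)
        (fun r hr => by simp [reflectedParameters, not_lt.2 hr, hcommon r hr])
        (fun r q hr hq => by simpa [reflectedParameters, hr, hq] using (hdistinct q r hq hr).symm)
      rw [hsi, paritySign_of_add_eq_one hs, reflectedWeight_reflectedParameters] at hdiag
      refine not_subsingleton_iff_nontrivial.2 (nontrivial_verma_of_twist (A := LevelYangian
        (s.interchange i i') p) (interchangeEquiv s p i i').symm hη ?_ ?_) h0
      · intro j l hjl x
        rw [interchangeEquiv_symm_evalT, hraise j l hjl]
      · intro j x
        rw [interchangeEquiv_symm_evalT, hdiag]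
    have h2 : Subsingleton (L s p (highestWeight a)) :=
      (Submodule.Quotient.mk_surjective _).subsingleton
    have h3 : Subsingleton (L (s.interchange i i') p
        (reflectedWeight (-paritySign (s.term i)) k i i' a)) :=
      (Submodule.Quotient.mk_surjective _).subsingleton
    exact isomorphicAlong_of_subsingleton _ _ _
  · have := isSimpleModule_L (s := s) (p := p) (highestWeight a)
    obtain ⟨ζ, hζ, hζ'⟩ := exists_isHighest_L (s := s) (p := p) (highestWeight a)
    obtain ⟨η, hη, hraise, hdiag⟩ := hζ'.exists_reflected hζ hi hs hcommon hdistinct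
    refine isomorphicAlong_L _ hη (fun j l hjl x => ?_) fun j x => ?_
    · rw [interchangeEquiv_evalT, hraise j l hjl]
    · rw [interchangeEquiv_evalT, hdiag]

end LevelYangian

end

theorem theorem4p4 (m n p : ℕ) (s : ParitySequence m n) (a : Fin (m + n) → Fin p → ℂ)
    (i i' : Fin (m + n)) (hi : (i' : ℕ) = (i : ℕ) + 1) (k : ℕ) (hk : k ≤ p)
    (hcommon : ∀ r : Fin p, k ≤ (r : ℕ) → a i r = a i' r)
    (hdistinct : ∀ r q : Fin p, (r : ℕ) < k → (q : ℕ) < k → a i r ≠ a i' q) :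
    (s.term i = 0 → s.term i' = 1 →
      IsomorphicAlong (LevelYangian.interchangeEquiv s p i i')
        (LevelYangian.L s p (highestWeight a))
        (LevelYangian.L (s.interchange i i') p (reflectedWeight (-1) k i i' a))) ∧
    (s.term i = 1 → s.term i' = 0 →
      IsomorphicAlong (LevelYangian.interchangeEquiv s p i i')
        (LevelYangian.L s p (highestWeight a))
        (LevelYangian.L (s.interchange i i') p (reflectedWeight 1 k i i' a))) := by
  refine ⟨fun h0 h1 => ?_, fun h1 h0 => ?_⟩
  · have h := LevelYangian.isomorphicAlong_reflected s a hi (by rw [h0, h1, zero_add])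
      hcommon hdistinct
    have hsign : -paritySign (s.term i) = -1 := by rw [h0, paritySign, if_pos rfl]
    rwa [hsign] at h
  · have h := LevelYangian.isomorphicAlong_reflected s a hi (by rw [h0, h1, add_zero])
      hcommon hdistinct
    have hsign : -paritySign (s.term i) = 1 := by
      rw [h1, paritySign, if_neg one_ne_zero, neg_neg]
    rwa [hsign] at h
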